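/- Consider Variable-Sized Bin Covering in the unit supply model: an instance consists of $m$ individual bins with demands $d_1,\dots,d_m>0$ and $n$ items with sizes $s_1,\dots,s_n\ge 0$ (real numbers). A solution is a family $S=(S_i)_{i=1}^m$ of pairwise disjoint sets of items; bin $i$ is covered if $\sum_{j\in S_i}s_j\ge d_i$, and the profit of $S$ is the sum of the demands $d_i$ of the covered bins. Let $\mathrm{OPT}$ be the maximum profit of a solution. The algorithm Next Fit Decreasing (NFD) sorts the bins by non-increasing demand and the items by non-increasing size (ties are broken arbitrarily) and considers the bins in this order. If the total size of the unassigned items is less than the demand of the current bin (or no item is left), the bin is skipped and stays empty; otherwise the bin receives the unassigned items in order, up to and including the first one with which it is covered. Let $\mathrm{NFD}$ be the profit of the solution returned. (a) NFD is a $9/4$-approximation algorithm: on every instance it returns a solution, and $\mathrm{OPT}\le\frac94\,\mathrm{NFD}$, however ties are broken. (b) NFD can be implemented with running time $O(n\log n+m\log m)$: there are a program for a real random access machine (unit-cost addition, subtraction and comparison of natural numbers and of real numbers, and indexed memory access) and a constant $C$ such that on every instance the program halts with a solution produced by NFD after at most $C(n\log n+m\log m+1)$ steps. (c) The bound is tight: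 for every $\rho<9/4$ there is an instance (with positive item sizes) with $\mathrm{NFD}>0$ and $\mathrm{OPT}>\rho\cdot\mathrm{NFD}$. Explicitly, for $0<\varepsilon<2/3$, the instance with four bins of demands $4,\,3-2\varepsilon,\,3-2\varepsilon,\,3-2\varepsilon$ and six items of sizes $2-\varepsilon,\,2-\varepsilon,\,2-\varepsilon,\,1-\varepsilon,\,1-\varepsilon,\,1-\varepsilon$ has $\mathrm{NFD}=4$ and $\mathrm{OPT}=9-6\varepsilon$, so that $\mathrm{OPT}/\mathrm{NFD}\ge 9/4-2\varepsilon$. -/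

import Mathlib

namespace BinCovering

open Finset

/-! ### Variable-Sized Bin Covering with unit supply

An instance has `m` individual bins with demands `d : Fin m → ℝ` (the profit of a bin is its demand)
and `n` items with sizes `s : Fin n → ℝ`. -/

/-- A solution: pairwise disjoint sets of items, `S i` being the items put into bin `i`. -/
def IsSolution {m n : ℕ} (S : Fin m → Finset (Fin n)) : Prop :=
  ∀ i i', i ≠ i' → Disjoint (S i) (S i')

open Classical in
/-- The profit of `S`: the sum of the demands of the covered bins. -/
noncomputable def profit {m n : ℕ} (d : Fin m → ℝ) (s : Fin n → ℝ)
    (S : Fin m → Finset (Fin n)) : ℝ :=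
  ∑ i : Fin m with d i ≤ ∑ j ∈ S i, s j, d i

/-- The maximum profit of a solution (a supremum over a finite nonempty set). -/
noncomputable def opt {m n : ℕ} (d : Fin m → ℝ) (s : Fin n → ℝ) : ℝ :=
  sSup {p : ℝ | ∃ S : Fin m → Finset (Fin n), IsSolution S ∧ p = profit d s S}

/-! ### Next Fit Decreasing -/

/-- The items with (zero-based) positions `a, …, b - 1`. -/
def block (n a b : ℕ) : Finset (Fin n) :=
  univ.filter fun l => a ≤ (l : ℕ) ∧ (l : ℕ) < b

open Classical in
/-- The position of the first unassigned item at the moment when bin `i` becomes the current bin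
(positions of bins and items are counted from `0`). If the items from this position `j` on do not
suffice to cover bin `i`, the bin is skipped; otherwise it gets the items `j, …, j'`, where `j'` is
smallest such that they cover it, and the next position is `j' + 1`. -/
noncomputable def nfdStart {m n : ℕ} (d : Fin m → ℝ) (s : Fin n → ℝ) : ℕ → ℕ
  | 0 => 0
  | i + 1 =>
    if h : i < m then
      if nfdStart d s i < n ∧ d ⟨i, h⟩ ≤ ∑ l ∈ block n (nfdStart d s i) n, s l then
        sInf {b : ℕ | nfdStart d s i < b ∧ d ⟨i, h⟩ ≤ ∑ l ∈ block n (nfdStart d s i) b, s l}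
      else nfdStart d s i
    else nfdStart d s i

/-- The sets produced by the main loop of Next Fit Decreasing, for bins and items that have already
been sorted. -/
noncomputable def nfdSorted {m n : ℕ} (d : Fin m → ℝ) (s : Fin n → ℝ) (i : Fin m) :
    Finset (Fin n) :=
  block n (nfdStart d s i) (nfdStart d s (i + 1))

/-- `S` is an output of Next Fit Decreasing: sort the bins by non-increasing demand and the items by
non-increasing size (ties are broken arbitrarily), run the main loop, and undo the renaming. -/
def IsNFD {m n : ℕ} (d : Fin m → ℝ) (s : Fin n → ℝ) (S : Fin m → Finset (Fin n)) : Prop :=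
  ∃ (β : Equiv.Perm (Fin m)) (τ : Equiv.Perm (Fin n)),
    Antitone (d ∘ β) ∧ Antitone (s ∘ τ) ∧
      ∀ i, S (β i) = (nfdSorted (d ∘ β) (s ∘ τ) i).map τ.toEmbedding

/-! ### A real random access machine

Programs are written in a small imperative language. They work on registers and arrays of natural
numbers and on arrays of real numbers (finitely many of them occur in a program). The arithmetic
operations are addition and (truncated) subtraction of natural numbers and addition and subtraction
of real numbers; natural numbers and real numbers can be compared. Every operation, memory access,
comparison and command costs one step. -/

/-- The memory of the machine. -/
structure Store where
  /-- registers holding natural numbers -/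
  reg : ℕ → ℕ
  /-- `idx a k` is cell `k` of the array `a` of natural numbers -/
  idx : ℕ → ℕ → ℕ
  /-- `val a k` is cell `k` of the array `a` of real numbers -/
  val : ℕ → ℕ → ℝ

/-- Expressions for natural numbers. -/
inductive NExp where
  | const (k : ℕ)
  | reg (x : ℕ)
  | read (a : ℕ) (e : NExp)
  | plus (e f : NExp)
  | minus (e f : NExp)

/-- The value of an expression. -/
def NExp.eval (σ : Store) : NExp → ℕ
  | const k => k
  | reg x => σ.reg x
  | read a e => σ.idx a (e.eval σ)
  | plus e f => e.eval σ + f.eval σ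
  | minus e f => e.eval σ - f.eval σ

/-- The number of steps for the evaluation of an expression. -/
def NExp.cost : NExp → ℕ
  | const _ => 1
  | reg _ => 1
  | read _ e => e.cost + 1
  | plus e f => e.cost + f.cost + 1
  | minus e f => e.cost + f.cost + 1

/-- Expressions for real numbers. -/
inductive RExp where
  | zero
  | read (a : ℕ) (e : NExp)
  | plus (e f : RExp)
  | minus (e f : RExp)

/-- The value of an expression. -/
def RExp.eval (σ : Store) : RExp → ℝ
  | zero => 0
  | read a e => σ.val a (e.eval σ)
  | plus e f => e.eval σ + f.eval σ
  | minus e f => e.eval σ - f.eval σ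

/-- The number of steps for the evaluation of an expression. -/
def RExp.cost : RExp → ℕ
  | zero => 1
  | read _ e => e.cost + 1
  | plus e f => e.cost + f.cost + 1
  | minus e f => e.cost + f.cost + 1

/-- Tests. -/
inductive Test where
  | natLt (e f : NExp)
  | realLt (e f : RExp)
  | neg (b : Test)
  | both (b c : Test)

/-- The truth of a test. -/
def Test.Holds (σ : Store) : Test → Prop
  | natLt e f => e.eval σ < f.eval σ
  | realLt e f => e.eval σ < f.eval σ
  | neg b => ¬ b.Holds σ
  | both b c => b.Holds σ ∧ c.Holds σ

/-- The number of steps for a test. -/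
def Test.cost : Test → ℕ
  | natLt e f => e.cost + f.cost + 1
  | realLt e f => e.cost + f.cost + 1
  | neg b => b.cost + 1
  | both b c => b.cost + c.cost + 1

/-- Programs. -/
inductive Prog where
  | skip
  | setReg (x : ℕ) (e : NExp)
  | setIdx (a : ℕ) (k e : NExp)
  | setVal (a : ℕ) (k : NExp) (e : RExp)
  | seq (P Q : Prog)
  | branch (b : Test) (P Q : Prog)
  | loop (b : Test) (P : Prog)

/-- `Runs P σ t σ'`: started in the memory `σ`, the program `P` halts after exactly `t` steps in the
memory `σ'`. -/
inductive Runs : Prog → Store → ℕ → Store → Prop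
  | skip (σ : Store) : Runs .skip σ 1 σ
  | setReg (σ : Store) (x : ℕ) (e : NExp) :
      Runs (.setReg x e) σ (e.cost + 1) { σ with reg := Function.update σ.reg x (e.eval σ) }
  | setIdx (σ : Store) (a : ℕ) (k e : NExp) :
      Runs (.setIdx a k e) σ (k.cost + e.cost + 1)
        { σ with idx := Function.update σ.idx a (Function.update (σ.idx a) (k.eval σ) (e.eval σ)) }
  | setVal (σ : Store) (a : ℕ) (k : NExp) (e : RExp) :
      Runs (.setVal a k e) σ (k.cost + e.cost + 1)
        { σ with val := Function.update σ.val a (Function.update (σ.val a) (k.eval σ) (e.eval σ)) }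
  | seq {P Q : Prog} {σ σ' σ'' : Store} {t u : ℕ} :
      Runs P σ t σ' → Runs Q σ' u σ'' → Runs (.seq P Q) σ (t + u + 1) σ''
  | branchTrue {b : Test} {P Q : Prog} {σ σ' : Store} {t : ℕ} :
      b.Holds σ → Runs P σ t σ' → Runs (.branch b P Q) σ (b.cost + t + 1) σ'
  | branchFalse {b : Test} {P Q : Prog} {σ σ' : Store} {t : ℕ} :
      ¬ b.Holds σ → Runs Q σ t σ' → Runs (.branch b P Q) σ (b.cost + t + 1) σ'
  | loopStop {b : Test} {P : Prog} {σ : Store} :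
      ¬ b.Holds σ → Runs (.loop b P) σ (b.cost + 1) σ
  | loopStep {b : Test} {P : Prog} {σ σ' σ'' : Store} {t u : ℕ} :
      b.Holds σ → Runs P σ t σ' → Runs (.loop b P) σ' u σ'' →
        Runs (.loop b P) σ (b.cost + t + u + 1) σ''

/-- The initial memory for an instance: the numbers of items and bins are in the registers `0` and
`1`, the sizes in the real array `0`, the demands in the real array `1`; all else is zero. -/
noncomputable def inputStore {m n : ℕ} (d : Fin m → ℝ) (s : Fin n → ℝ) : Store where
  reg x := if x = 0 then n else if x = 1 then m else 0
  idx _ _ := 0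
  val a k :=
    if a = 0 then (if h : k < n then s ⟨k, h⟩ else 0)
    else if a = 1 then (if h : k < m then d ⟨k, h⟩ else 0)
    else 0

/-- The solution that is read off from the final memory: item `j` is in bin `i` if cell `j` of the
natural number array `0` holds `i + 1` (bins are counted from `0`). -/
def outputSolution (m n : ℕ) (σ : Store) (i : Fin m) : Finset (Fin n) :=
  univ.filter fun j => σ.idx 0 j = i + 1

end BinCovering

/-!
### Why Next Fit Decreasing is a `9 / 4`-approximation

Cut the run of the algorithm, on sorted bins and items, into phases. A phase is a maximal block of
consecutive covered bins; it ends at a skipped bin, whose demand `δ` exceeds the total size `R` of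
the items that are left. `sum_le_gain` shows by induction from the back that, at every moment, no
solution for the bins and items that are left earns more than `9 / 4` times what the algorithm earns
from now on. The step is `sum_le_of_phase`. Let `D` be the profit of the phase and `N` the later
profit of the algorithm.

* If no bin of the phase gets three items, then a solution has at most two bins per bin of the phase
  that use an item of the phase. The demand of a bin outside the phase is at most `δ`, so they earn
  at most `2 * D` (`sum_touching_le`), and by induction the other bins earn at most `9 / 4 * N`.
* In general, cut the items off at `δ`. A bin of demand `b` then gets less than `b + δ`, and this
  bounds any solution by `2 * D + R`. If some bin `c` has at least three items, the last one has size
  at most half of its demand, and the bound improves to `2 * D + d c / 2` (`sum_le_of_three_items`).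
  This suffices if `d c` is at most `D / 2`, in particular if `c` is not the first bin of the phase.
  With at least three bins in the phase, `R` is otherwise at most `D / 4`; with two bins, the total
  size of the items is otherwise at most `2 * D`.
* There remain the phases of one bin with at least three items, the last one of size `a ≤ D / 2`
  (`sum_le_of_single_phase`). If the total size, which is below `D + a + R`, exceeds
  `9 / 4 * (D + N)`, then `a > D / 4`, so the bin has at most four items; moreover `N < D / 9` and
  `R > 3 / 4 * D`. At most two bins of the solution have a demand above `R`. All other bins that use
  an item of the phase have a demand of at most `N`, and if there are two bins above `R`, these use
  up so many items of the phase that only two such bins remain.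

For the running time, `mergeSort` is bottom-up merge sort on indices. Every pass writes its output
behind its input, so that one array suffices, and there are `Nat.clog 2 n` passes of linear time. The
main loop moves every bin and every item once. Correctness and running time are proved together, with
the rules for `Reaches`. The tight instances are a computation.
-/

namespace BinCovering

open Finset

section Blocks

/-! ### Blocks of items and the main loop -/

variable {m n : ℕ} {d : Fin m → ℝ} {s : Fin n → ℝ}

theorem mem_block {a b : ℕ} {l : Fin n} : l ∈ block n a b ↔ a ≤ (l : ℕ) ∧ (l : ℕ) < b := by
  simp [block]

theorem sum_block_self (f : Fin n → ℝ) (a : ℕ) : ∑ l ∈ block n a a, f l = 0 := by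
  apply sum_eq_zero
  intro l hl
  rw [mem_block] at hl
  omega

theorem sum_block_add (f : Fin n → ℝ) {a b c : ℕ} (hab : a ≤ b) (hbc : b ≤ c) :
    ∑ l ∈ block n a b, f l + ∑ l ∈ block n b c, f l = ∑ l ∈ block n a c, f l := by
  rw [← sum_union]
  · congr 1
    ext l
    simp only [mem_union, mem_block]
    omega
  · rw [disjoint_left]
    intro l h1 h2
    rw [mem_block] at h1 h2
    omega

theorem sum_block_succ (f : Fin n → ℝ) {a b : ℕ} (hab : a ≤ b) (hb : b < n) :
    ∑ l ∈ block n a (b + 1), f l = ∑ l ∈ block n a b, f l + f ⟨b, hb⟩ := by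
  rw [← sum_block_add f hab (Nat.le_succ b)]
  congr 1
  rw [show block n b (b + 1) = {⟨b, hb⟩} by
    ext l
    simp only [mem_block, mem_singleton, Fin.ext_iff]
    omega]
  simp

theorem card_block_le (a b : ℕ) : #(block n a b) ≤ b - a := by
  have : #((block n a b).map Fin.valEmbedding) ≤ #(Ico a b) := by
    apply card_le_card
    intro x hx
    simp only [mem_map, mem_block] at hx
    obtain ⟨l, hl, rfl⟩ := hx
    simpa using hl
  simpa using this

/-- Bin `i` gets covered in the main loop of Next Fit Decreasing. -/
def Fills (d : Fin m → ℝ) (s : Fin n → ℝ) (i : Fin m) : Prop :=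
  nfdStart d s i < n ∧ d i ≤ ∑ l ∈ block n (nfdStart d s i) n, s l

theorem nfdStart_succ_of_fills {i : Fin m} (h : Fills d s i) :
    nfdStart d s (i + 1) = sInf {b : ℕ | nfdStart d s i < b ∧
      d i ≤ ∑ l ∈ block n (nfdStart d s i) b, s l} := by
  have h' : nfdStart d s i < n ∧ d ⟨i, i.2⟩ ≤ ∑ l ∈ block n (nfdStart d s i) n, s l := h
  rw [nfdStart, dif_pos i.2, if_pos h']

theorem nfdStart_succ_of_not_fills {i : Fin m} (h : ¬ Fills d s i) :
    nfdStart d s (i + 1) = nfdStart d s i := by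
  have h' : ¬ (nfdStart d s i < n ∧ d ⟨i, i.2⟩ ≤ ∑ l ∈ block n (nfdStart d s i) n, s l) := h
  rw [nfdStart, dif_pos i.2, if_neg h']

theorem Fills.lt_succ {i : Fin m} (h : Fills d s i) :
    nfdStart d s i < nfdStart d s (i + 1) := by
  rw [nfdStart_succ_of_fills h]
  exact (Nat.sInf_mem (⟨n, h⟩ : {b : ℕ | nfdStart d s i < b ∧
      d i ≤ ∑ l ∈ block n (nfdStart d s i) b, s l}.Nonempty)).1

theorem Fills.covered {i : Fin m} (h : Fills d s i) :
    d i ≤ ∑ l ∈ block n (nfdStart d s i) (nfdStart d s (i + 1)), s l := by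
  rw [nfdStart_succ_of_fills h]
  exact (Nat.sInf_mem (⟨n, h⟩ : {b : ℕ | nfdStart d s i < b ∧
      d i ≤ ∑ l ∈ block n (nfdStart d s i) b, s l}.Nonempty)).2

theorem Fills.succ_le {i : Fin m} (h : Fills d s i) : nfdStart d s (i + 1) ≤ n := by
  rw [nfdStart_succ_of_fills h]
  exact Nat.sInf_le h

theorem Fills.lt_of_lt {i : Fin m} (hd : 0 < d i) (h : Fills d s i) {b : ℕ}
    (hb : nfdStart d s i ≤ b) (hb' : b < nfdStart d s (i + 1)) :
    ∑ l ∈ block n (nfdStart d s i) b, s l < d i := by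
  rcases hb.eq_or_lt with rfl | hlt
  · rwa [sum_block_self]
  · by_contra! hcon
    rw [nfdStart_succ_of_fills h] at hb'
    exact Nat.notMem_of_lt_sInf hb' ⟨hlt, hcon⟩

/-- The last item put into a covered bin, and the fact that the bin is not covered without it. -/
theorem Fills.exists_last {i : Fin m} (hd : 0 < d i) (h : Fills d s i) :
    ∃ l : Fin n, nfdStart d s i ≤ l ∧ nfdStart d s (i + 1) = l + 1 ∧
      ∑ x ∈ block n (nfdStart d s i) l, s x < d i ∧
      ∀ f : Fin n → ℝ, ∑ x ∈ block n (nfdStart d s i) (nfdStart d s (i + 1)), f x =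
        ∑ x ∈ block n (nfdStart d s i) l, f x + f l := by
  have h1 := h.lt_succ
  have h2 := h.succ_le
  obtain ⟨l, hl⟩ : ∃ l, nfdStart d s (i + 1) = l + 1 :=
    ⟨nfdStart d s (i + 1) - 1, by omega⟩
  refine ⟨⟨l, by omega⟩, by simp only; omega, hl, h.lt_of_lt hd (by simp only; omega)
    (by simp only; omega), fun f => ?_⟩
  rw [hl, sum_block_succ f (by omega) (by omega)]

theorem nfdStart_le_succ (i : ℕ) : nfdStart d s i ≤ nfdStart d s (i + 1) := by
  by_cases hi : i < m
  · by_cases h : Fills d s ⟨i, hi⟩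
    · exact h.lt_succ.le
    · exact (nfdStart_succ_of_not_fills h).ge
  · rw [nfdStart, dif_neg hi]

theorem nfdStart_mono : Monotone (nfdStart d s) := monotone_nat_of_le_succ nfdStart_le_succ

theorem nfdStart_le (i : ℕ) : nfdStart d s i ≤ n := by
  induction i with
  | zero => simp [nfdStart]
  | succ i ih =>
    by_cases hi : i < m
    · by_cases h : Fills d s ⟨i, hi⟩
      · exact h.succ_le
      · exact (nfdStart_succ_of_not_fills h).trans_le ih
    · rwa [nfdStart, dif_neg hi]

/-- A bound on the items of each covered bin bounds the items of consecutive covered bins. -/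
theorem sum_block_le_of_fills {i k : ℕ} (hik : i ≤ k) (hk : k ≤ m) (f : Fin n → ℝ) (c : Fin m → ℝ)
    (hc : ∀ b : Fin m, i ≤ b → (b : ℕ) < k →
      ∑ l ∈ block n (nfdStart d s b) (nfdStart d s (b + 1)), f l ≤ c b) :
    ∑ l ∈ block n (nfdStart d s i) (nfdStart d s k), f l ≤ ∑ b ∈ block m i k, c b := by
  induction k, hik using Nat.le_induction with
  | base => simp only [sum_block_self, le_refl]
  | succ k hik ih =>
    rw [sum_block_succ c hik (by omega),
      ← sum_block_add f (nfdStart_mono hik) (nfdStart_le_succ k)]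
    exact add_le_add (ih (by omega) fun b h1 h2 => hc b h1 (by omega)) (hc ⟨k, by omega⟩ hik (by simp))

/-! ### Upper bounds for arbitrary solutions -/

theorem sum_demand_le_sum_size (hs : ∀ j, 0 ≤ s j) {O : Finset (Fin m)}
    {S : Fin m → Finset (Fin n)} {U : Finset (Fin n)} (hdisj : (O : Set (Fin m)).PairwiseDisjoint S)
    (hU : ∀ b ∈ O, S b ⊆ U) (hcov : ∀ b ∈ O, d b ≤ ∑ j ∈ S b, s j) :
    ∑ b ∈ O, d b ≤ ∑ j ∈ U, s j := by
  calc ∑ b ∈ O, d b ≤ ∑ b ∈ O, ∑ j ∈ S b, s j := sum_le_sum hcov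
    _ = ∑ j ∈ O.biUnion S, s j := (sum_biUnion hdisj).symm
    _ ≤ ∑ j ∈ U, s j :=
      sum_le_sum_of_subset_of_nonneg (biUnion_subset.2 hU) fun j _ _ => hs j

theorem min_sum_le_sum_min {θ : ℝ} (hθ : 0 ≤ θ) (hs : ∀ j, 0 ≤ s j) (X : Finset (Fin n)) :
    min (∑ j ∈ X, s j) θ ≤ ∑ j ∈ X, min (s j) θ := by
  induction X using Finset.induction_on with
  | empty => simp [hθ]
  | insert a X ha ih =>
    rw [sum_insert ha, sum_insert ha]
    have h0 : 0 ≤ ∑ j ∈ X, s j := sum_nonneg fun j _ => hs j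
    have ha0 := hs a
    rcases le_total (s a) θ with h1 | h1 <;> rcases le_total (∑ j ∈ X, s j) θ with h2 | h2 <;>
      rcases le_total (s a + ∑ j ∈ X, s j) θ with h3 | h3 <;>
      simp only [min_eq_left, min_eq_right, h1, h2, h3] at ih ⊢ <;> linarith

/-- Cutting off the items at `θ`, an item never counts more than `θ`, at the price of adding the
excess over `θ` of the demands. -/
theorem sum_demand_le_truncated {θ : ℝ} (hθ : 0 ≤ θ) (hs : ∀ j, 0 ≤ s j) {O : Finset (Fin m)}
    {S : Fin m → Finset (Fin n)} {U : Finset (Fin n)} (hdisj : (O : Set (Fin m)).PairwiseDisjoint S)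
    (hU : ∀ b ∈ O, S b ⊆ U) (hcov : ∀ b ∈ O, d b ≤ ∑ j ∈ S b, s j) :
    ∑ b ∈ O, d b ≤ ∑ b ∈ O, max (d b - θ) 0 + ∑ j ∈ U, min (s j) θ := by
  have h1 : ∑ b ∈ O, min (d b) θ ≤ ∑ j ∈ U, min (s j) θ :=
    sum_demand_le_sum_size (s := fun j => min (s j) θ) (fun j => le_min (hs j) hθ) hdisj hU
      fun b hb => (min_le_min_right θ (hcov b hb)).trans (min_sum_le_sum_min hθ hs _)
  have h2 : ∑ b ∈ O, d b = ∑ b ∈ O, max (d b - θ) 0 + ∑ b ∈ O, min (d b) θ := by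
    rw [← sum_add_distrib]
    refine sum_congr rfl fun b _ => ?_
    rcases le_total (d b) θ with h | h
    · rw [min_eq_left h, max_eq_right (by linarith), zero_add]
    · rw [min_eq_right h, max_eq_left (by linarith), sub_add_cancel]
  linarith

end Blocks

section Phases

/-! ### Phases of the algorithm -/

variable {m n : ℕ} {d : Fin m → ℝ} {s : Fin n → ℝ}

theorem card_le_card_of_touching {O : Finset (Fin m)} {S : Fin m → Finset (Fin n)}
    {A : Finset (Fin n)} (hdisj : (O : Set (Fin m)).PairwiseDisjoint S)
    (h : ∀ b ∈ O, ∃ j ∈ S b, j ∈ A) : #O ≤ #A := by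
  refine card_le_card_of_forall_subsingleton (fun b j => j ∈ S b)
    (fun b hb => (h b hb).imp fun j hj => hj.symm) fun j _ b hb b' hb' => ?_
  by_contra hne
  exact disjoint_left.1 (hdisj hb.1 hb'.1 hne) hb.2 hb'.2

theorem sum_excess_le {i k : ℕ} (hk : k < m) (hda : Antitone d) {O : Finset (Fin m)}
    (hO : ∀ b ∈ O, i ≤ b) :
    ∑ b ∈ O, max (d b - d ⟨k, hk⟩) 0 ≤ ∑ b ∈ block m i k, (d b - d ⟨k, hk⟩) := by
  have h1 : ∀ b ∈ block m i k, 0 ≤ d b - d ⟨k, hk⟩ := fun b hb =>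
    sub_nonneg.2 (hda (Fin.le_def.2 (mem_block.1 hb).2.le))
  calc ∑ b ∈ O, max (d b - d ⟨k, hk⟩) 0
      = ∑ b ∈ O.filter fun b : Fin m => (b : ℕ) < k, max (d b - d ⟨k, hk⟩) 0 := by
        rw [sum_filter]
        refine sum_congr rfl fun b _ => ?_
        split_ifs with h
        · rfl
        · exact max_eq_right (sub_nonpos.2 (hda (Fin.le_def.2 (not_lt.1 h))))
    _ ≤ ∑ b ∈ block m i k, max (d b - d ⟨k, hk⟩) 0 :=
        sum_le_sum_of_subset_of_nonneg
          (fun b hb => mem_block.2 ⟨hO b (mem_filter.1 hb).1, (mem_filter.1 hb).2⟩)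
          fun _ _ _ => le_max_right _ _
    _ = _ := sum_congr rfl fun b hb => max_eq_left (h1 b hb)

theorem last_le_half {b : Fin m} (hd : 0 < d b) (hsa : Antitone s)
    (h : Fills d s b) (h3 : nfdStart d s b + 3 ≤ nfdStart d s (b + 1)) {l : Fin n}
    (hl : nfdStart d s (b + 1) ≤ l + 1) : 2 * s l ≤ d b := by
  have hle := h.succ_le
  have h1 := h.lt_of_lt hd (b := nfdStart d s b + 2) (by omega) (by omega)
  rw [sum_block_succ s (by omega) (by omega), sum_block_succ s (by omega) (by omega),
    sum_block_self] at h1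
  have h2 : s l ≤ s ⟨nfdStart d s b, by omega⟩ := hsa (Fin.le_def.2 (by simp only; omega))
  have h4 : s l ≤ s ⟨nfdStart d s b + 1, by omega⟩ := hsa (Fin.le_def.2 (by simp only; omega))
  linarith

/-- If no bin of the phase gets more than two items, the bins of any solution that use an item of
the phase earn at most twice the profit of the phase. -/
theorem sum_touching_le {i k : ℕ} (hik : i ≤ k) (hk : k < m) (hd : ∀ b, 0 < d b) (hda : Antitone d)
    (h2 : ∀ b : Fin m, i ≤ b → (b : ℕ) < k → nfdStart d s (b + 1) ≤ nfdStart d s b + 2)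
    {O : Finset (Fin m)} {S : Fin m → Finset (Fin n)}
    (hdisj : (O : Set (Fin m)).PairwiseDisjoint S) (hO : ∀ b ∈ O, i ≤ b)
    (htouch : ∀ b ∈ O, ∃ j ∈ S b, j ∈ block n (nfdStart d s i) (nfdStart d s k)) :
    ∑ b ∈ O, d b ≤ 2 * ∑ b ∈ block m i k, d b := by
  set δ := d ⟨k, hk⟩ with hδ
  have hδ0 : 0 < δ := hd _
  have hcard : (#O : ℝ) ≤ 2 * #(block m i k) := by
    have h3 : (#O : ℝ) ≤ #(block n (nfdStart d s i) (nfdStart d s k)) :=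
      mod_cast card_le_card_of_touching hdisj htouch
    have h4 := sum_block_le_of_fills (d := d) (s := s) hik hk.le (fun _ => 1) (fun _ => 2)
      fun b hb hb' => by
        have h5 := card_block_le (n := n) (nfdStart d s b) (nfdStart d s (b + 1))
        have h6 := h2 b hb hb'
        rw [sum_const, nsmul_one]
        exact_mod_cast (by omega : #(block n (nfdStart d s b) (nfdStart d s (b + 1))) ≤ 2)
    simp only [sum_const, nsmul_eq_mul, mul_one] at h4
    linarith
  have h5 : ∑ b ∈ O, d b ≤ ∑ b ∈ O, (max (d b - δ) 0 + δ) :=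
    sum_le_sum fun b _ => by linarith [le_max_left (d b - δ) 0]
  have h6 := sum_excess_le hk hda hO
  have h7 : ∑ b ∈ block m i k, δ ≤ ∑ b ∈ block m i k, d b :=
    sum_le_sum fun b hb => hda (Fin.le_def.2 (mem_block.1 hb).2.le)
  rw [sum_add_distrib, sum_const, nsmul_eq_mul] at h5
  rw [sum_sub_distrib, sum_const, nsmul_eq_mul] at h6
  rw [sum_const, nsmul_eq_mul] at h7
  nlinarith

/-- The bound from cutting off the items at the demand of the first skipped bin. A bin with at
least three items contains, when cut off, half of its demand less than its fair share. -/
theorem sum_le_of_three_items {i k : ℕ} (hik : i ≤ k) (hk : k < m) (hd : ∀ b, 0 < d b)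
    (hs : ∀ j, 0 ≤ s j) (hda : Antitone d) (hsa : Antitone s)
    (hfill : ∀ b : Fin m, i ≤ b → (b : ℕ) < k → Fills d s b)
    {c : Fin m} (hc : i ≤ c) (hck : (c : ℕ) < k)
    (h3 : nfdStart d s c + 3 ≤ nfdStart d s (c + 1))
    {O : Finset (Fin m)} {S : Fin m → Finset (Fin n)}
    (hdisj : (O : Set (Fin m)).PairwiseDisjoint S) (hO : ∀ b ∈ O, i ≤ b)
    (hU : ∀ b ∈ O, S b ⊆ block n (nfdStart d s i) n) (hcov : ∀ b ∈ O, d b ≤ ∑ j ∈ S b, s j) :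
    ∑ b ∈ O, d b ≤ 2 * ∑ b ∈ block m i k, d b + ∑ j ∈ block n (nfdStart d s k) n, s j
      + min (d c / 2 - d ⟨k, hk⟩) 0 := by
  set δ := d ⟨k, hk⟩ with hδ
  have hδ0 : 0 < δ := hd _
  have h1 := sum_demand_le_truncated hδ0.le hs hdisj hU hcov
  have h2 := sum_excess_le hk hda hO
  rw [← sum_block_add _ (nfdStart_mono hik) (nfdStart_le k)] at h1
  have h4 : ∑ j ∈ block n (nfdStart d s k) n, min (s j) δ ≤
      ∑ j ∈ block n (nfdStart d s k) n, s j := sum_le_sum fun j _ => min_le_left _ _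
  have h5 := sum_block_le_of_fills (d := d) (s := s) hik hk.le (fun j => min (s j) δ)
    (fun b => d b + (δ + if b = c then min (d c / 2 - δ) 0 else 0)) fun b hb hb' => by
      have hf := hfill b hb hb'
      obtain ⟨l, hl, hl', hlt, hsum⟩ := hf.exists_last (hd b)
      rw [hsum]
      have h6 : ∑ j ∈ block n (nfdStart d s b) l, min (s j) δ ≤
        ∑ j ∈ block n (nfdStart d s b) l, s j := sum_le_sum fun j _ => min_le_left _ _
      have h7 := min_le_right (s l) δ
      have h8 := min_le_left (s l) δ
      split_ifs with hbc
      · subst hbc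
        have h9 := last_le_half (hd b) hsa hf h3 hl'.le
        rcases min_cases (d b / 2 - δ) 0 with h | h <;> linarith
      · linarith
  rw [sum_add_distrib, sum_add_distrib, sum_ite_eq' , if_pos (mem_block.2 ⟨hc, hck⟩)] at h5
  rw [sum_sub_distrib] at h2
  linarith

end Phases

section PhaseBound

variable {m n : ℕ} {d : Fin m → ℝ} {s : Fin n → ℝ}

/-- The bound for a phase that covers only one bin, with at least three items. -/
theorem sum_le_of_single_phase {i k : ℕ} (hik : i + 1 = k) (hk : k < m) (hd : ∀ b, 0 < d b)
    (hs : ∀ j, 0 ≤ s j) (hda : Antitone d) (hsa : Antitone s)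
    (hfill : Fills d s ⟨i, by omega⟩)
    (h3 : nfdStart d s i + 3 ≤ nfdStart d s k)
    (hrest : ∑ j ∈ block n (nfdStart d s k) n, s j < d ⟨k, hk⟩)
    {O : Finset (Fin m)} {S : Fin m → Finset (Fin n)}
    (hdisj : (O : Set (Fin m)).PairwiseDisjoint S) (hO : ∀ b ∈ O, i ≤ b)
    (hU : ∀ b ∈ O, S b ⊆ block n (nfdStart d s i) n) (hcov : ∀ b ∈ O, d b ≤ ∑ j ∈ S b, s j)
    {N e : ℝ} (he : 0 ≤ e) (heN : e ≤ N)
    (hlow : ∀ b ∈ O, d b ≤ ∑ j ∈ block n (nfdStart d s k) n, s j → d b ≤ e)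
    (hind : ∀ O' ⊆ O, (∀ b ∈ O', S b ⊆ block n (nfdStart d s k) n) → ∑ b ∈ O', d b ≤ 9 / 4 * N) :
    ∑ b ∈ O, d b ≤ 9 / 4 * (d ⟨i, by omega⟩ + N) := by
  classical
  subst hik
  set D := d ⟨i, by omega⟩ with hD
  set R := ∑ j ∈ block n (nfdStart d s (i + 1)) n, s j with hR
  set A := block n (nfdStart d s i) (nfdStart d s (i + 1)) with hA
  have hD0 : 0 < D := hd _
  have hR0 : 0 ≤ R := sum_nonneg fun j _ => hs j
  have hOD : ∀ b ∈ O, d b ≤ D := fun b hb => hda (Fin.le_def.2 (hO b hb))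
  have hRD : R < D := hrest.trans_le (hda (Fin.le_def.2 (by simp)))
  -- otherwise the solution, and hence the total size, exceeds `9 / 4 * (D + N)`
  by_contra! hcon
  -- the total size is `α + R`, where `α` is the size of the items of the bin
  set α := ∑ j ∈ A, s j with hα
  have hT : ∑ j ∈ block n (nfdStart d s i) n, s j = α + R :=
    (sum_block_add s (nfdStart_mono (Nat.le_succ i)) (nfdStart_le _)).symm
  have hOT := sum_demand_le_sum_size hs hdisj hU hcov
  rw [hT] at hOT
  obtain ⟨l, hl, hl', hlt, hsum⟩ := hfill.exists_last (hd _)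
  simp only at hl hl' hlt hsum
  have hαa : α < D + s l := by rw [hα, hA, hsum]; linarith
  have haD : 2 * s l ≤ D := last_le_half (hd _) hsa hfill h3 hl'.le
  have ha4 : D < 4 * s l := by linarith
  have hR34 : 3 / 4 * D < R := by linarith
  have hN : N < D / 9 := by linarith
  -- so the bin has three or four items
  have hA4 : #A ≤ 4 := by
    by_contra! h5
    have h6 : #A ≤ _ := card_block_le (n := n) (nfdStart d s i) (nfdStart d s (i + 1))
    have h7 : ∑ j ∈ block n (nfdStart d s i) (nfdStart d s i + 4), s j ≤
        ∑ j ∈ block n (nfdStart d s i) l, s j := by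
      refine sum_le_sum_of_subset_of_nonneg (fun j hj => ?_) fun j _ _ => hs j
      rw [mem_block] at hj ⊢
      omega
    have h8 : ∀ j : Fin n, (j : ℕ) ≤ l → s l ≤ s j := fun j hj => hsa (Fin.le_def.2 hj)
    have hln := l.2
    rw [sum_block_succ s (by omega) (by omega), sum_block_succ s (by omega) (by omega),
      sum_block_succ s (by omega) (by omega), sum_block_succ s (by omega) (by omega),
      sum_block_self] at h7
    linarith [h8 ⟨nfdStart d s i, by omega⟩ (by simp only; omega),
      h8 ⟨nfdStart d s i + 1, by omega⟩ (by simp only; omega),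
      h8 ⟨nfdStart d s i + 2, by omega⟩ (by simp only; omega),
      h8 ⟨nfdStart d s i + 3, by omega⟩ (by simp only; omega)]
  -- the bins that earn more than `R`, the other bins that use an item of `A`, and the rest
  set H := O.filter fun b => R < d b with hH
  set L := O.filter fun b => d b ≤ R ∧ ¬ S b ⊆ block n (nfdStart d s (i + 1)) n with hL
  have hsplit : ∑ b ∈ O, d b ≤ ∑ b ∈ H, d b + ∑ b ∈ L, d b + 9 / 4 * N := by
    have h1 := hind (O.filter fun b => d b ≤ R ∧ S b ⊆ block n (nfdStart d s (i + 1)) n)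
      (filter_subset _ _) fun b hb => (mem_filter.1 hb).2.2
    rw [← sum_filter_add_sum_filter_not O (fun b => R < d b) d,
      ← sum_filter_add_sum_filter_not (O.filter fun b => ¬ R < d b)
        (fun b => ¬ S b ⊆ block n (nfdStart d s (i + 1)) n) d, filter_filter, filter_filter]
    simp only [not_lt, not_not]
    linarith
  have hHO : H ⊆ O := filter_subset _ _
  have hLO : L ⊆ O := filter_subset _ _
  have hLe : ∑ b ∈ L, d b ≤ #L * e := by
    rw [← nsmul_eq_mul]
    exact sum_le_card_nsmul _ _ _ fun b hb =>
      hlow b (hLO hb) (mem_filter.1 hb).2.1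
  have hHD : ∑ b ∈ H, d b ≤ #H * D := by
    rw [← nsmul_eq_mul]
    exact sum_le_card_nsmul _ _ _ fun b hb => hOD b (hHO hb)
  have hHR : #H * R ≤ ∑ b ∈ H, d b := by
    rw [← nsmul_eq_mul]
    exact card_nsmul_le_sum _ _ _ fun b hb => (mem_filter.1 hb).2.le
  have hL_touch : ∀ b ∈ L, ∃ j ∈ S b, j ∈ A := by
    intro b hb
    obtain ⟨hbO, -, hns⟩ := mem_filter.1 hb
    obtain ⟨j, hj, hj'⟩ := not_subset.1 hns
    refine ⟨j, hj, ?_⟩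
    have h1 := hU b hbO hj
    rw [mem_block] at h1 hj'
    rw [hA, mem_block]
    omega
  have hdisjH : (H : Set (Fin m)).PairwiseDisjoint S := hdisj.subset (by exact_mod_cast hHO)
  have hdisjL : (L : Set (Fin m)).PairwiseDisjoint S := hdisj.subset (by exact_mod_cast hLO)
  set X := H.biUnion S with hX
  have hHX : ∑ b ∈ H, d b ≤ ∑ j ∈ X, s j := by
    rw [hX, sum_biUnion hdisjH]
    exact sum_le_sum fun b hb => hcov b (hHO hb)
  have hXAR : ∑ j ∈ X, s j ≤ ∑ j ∈ A ∩ X, s j + R := by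
    have h1 : X ⊆ (A ∩ X) ∪ block n (nfdStart d s (i + 1)) n := by
      intro j hj
      obtain ⟨b, hb, hjb⟩ := mem_biUnion.1 hj
      have h2 := hU b (hHO hb) hjb
      rw [mem_union, mem_inter, hA, mem_block, mem_block]
      rw [mem_block] at h2
      by_cases hc : (j : ℕ) < nfdStart d s (i + 1)
      · exact Or.inl ⟨⟨h2.1, hc⟩, hj⟩
      · exact Or.inr ⟨by omega, h2.2⟩
    refine (sum_le_sum_of_subset_of_nonneg h1 fun j _ _ => hs j).trans ?_
    rw [← sum_union_inter]
    exact le_add_of_nonneg_right (sum_nonneg fun j _ => hs j)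
  have hAX : ∑ j ∈ A ∩ X, s j ≤ α :=
    sum_le_sum_of_subset_of_nonneg inter_subset_left fun j _ _ => hs j
  have hcardL : #L ≤ #A - #(A ∩ X) := by
    rw [← card_sdiff_of_subset inter_subset_left, sdiff_inter_self_left]
    refine card_le_card_of_touching hdisjL fun b hb => ?_
    obtain ⟨j, hj, hjA⟩ := hL_touch b hb
    refine ⟨j, hj, mem_sdiff.2 ⟨hjA, fun hjX => ?_⟩⟩
    obtain ⟨b', hb', hjb'⟩ := mem_biUnion.1 hjX
    have hne : b ≠ b' := by
      rintro rfl
      exact (mem_filter.1 hb).2.1.not_gt (mem_filter.1 hb').2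
    exact disjoint_left.1 (hdisj (hLO hb) (hHO hb') hne) hj hjb'
  have hH2 : #H ≤ 2 := by
    by_contra! h
    have h1 : (3 : ℝ) ≤ #H := mod_cast h
    nlinarith
  rcases Nat.lt_or_ge #H 2 with hH1 | hH1
  · have h1 : (#H : ℝ) ≤ 1 := mod_cast (by omega)
    have h2 : (#L : ℝ) ≤ 4 := mod_cast (by omega)
    nlinarith
  · have h1 : (#H : ℝ) = 2 := mod_cast (by omega)
    rw [h1] at hHR hHD
    have h2 : 2 ≤ #(A ∩ X) := by
      by_contra! hlt2
      -- a single item of `A` has size at most `3 / 4 * D`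
      have h3 : ∑ j ∈ A ∩ X, s j ≤ 3 / 4 * D := by
        have h4 : ∀ j ∈ A ∩ X, s j ≤ 3 / 4 * D := by
          intro j hj
          have h5 := (mem_block.1 (mem_inter.1 hj).1).1
          have h6 : ∑ j ∈ block n (nfdStart d s i) (nfdStart d s i + 2), s j ≤
              ∑ j ∈ block n (nfdStart d s i) l, s j := by
            refine sum_le_sum_of_subset_of_nonneg (fun j hj => ?_) fun j _ _ => hs j
            rw [mem_block] at hj ⊢
            omega
          have hln := l.2
          rw [sum_block_succ s (by omega) (by omega), sum_block_succ s (by omega) (by omega),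
            sum_block_self] at h6
          have h7 : s j ≤ s ⟨nfdStart d s i, by omega⟩ := hsa (Fin.le_def.2 h5)
          have h8 : s l ≤ s ⟨nfdStart d s i + 1, by omega⟩ :=
            hsa (Fin.le_def.2 (by simp only; omega))
          linarith
        refine (sum_le_card_nsmul _ _ _ h4).trans ?_
        have : (#(A ∩ X) : ℝ) ≤ 1 := mod_cast (by omega)
        rw [nsmul_eq_mul]
        nlinarith
      linarith
    have h3 : (#L : ℝ) ≤ 2 := mod_cast (by omega)
    nlinarith

/-- The step of the induction. The bins from `i` to `k - 1` get covered, bin `k` is skipped, and `N`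
is the profit of the bins after that. The hypothesis `hlow` says that the bins that the rest of the
items could cover have demand at most `e`, the demand of the next bin that gets covered (or `0`). -/
theorem sum_le_of_phase {i k : ℕ} (hik : i < k) (hk : k < m) (hd : ∀ b, 0 < d b)
    (hs : ∀ j, 0 ≤ s j) (hda : Antitone d) (hsa : Antitone s)
    (hfill : ∀ b : Fin m, i ≤ b → (b : ℕ) < k → Fills d s b)
    (hrest : ∑ j ∈ block n (nfdStart d s k) n, s j < d ⟨k, hk⟩)
    {O : Finset (Fin m)} {S : Fin m → Finset (Fin n)}
    (hdisj : (O : Set (Fin m)).PairwiseDisjoint S) (hO : ∀ b ∈ O, i ≤ b)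
    (hU : ∀ b ∈ O, S b ⊆ block n (nfdStart d s i) n) (hcov : ∀ b ∈ O, d b ≤ ∑ j ∈ S b, s j)
    {N e : ℝ} (he : 0 ≤ e) (heN : e ≤ N)
    (hlow : ∀ b ∈ O, d b ≤ ∑ j ∈ block n (nfdStart d s k) n, s j → d b ≤ e)
    (hind : ∀ O' ⊆ O, (∀ b ∈ O', S b ⊆ block n (nfdStart d s k) n) → ∑ b ∈ O', d b ≤ 9 / 4 * N) :
    ∑ b ∈ O, d b ≤ 9 / 4 * (∑ b ∈ block m i k, d b + N) := by
  classical
  have hD0 : 0 ≤ ∑ b ∈ block m i k, d b := sum_nonneg fun b _ => (hd b).le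
  by_cases h2 : ∀ b : Fin m, i ≤ b → (b : ℕ) < k → nfdStart d s (b + 1) ≤ nfdStart d s b + 2
  · have h3 := hind (O.filter fun b => S b ⊆ block n (nfdStart d s k) n) (filter_subset _ _)
      fun b hb => (mem_filter.1 hb).2
    have h4 := sum_touching_le (O := O.filter fun b => ¬ S b ⊆ block n (nfdStart d s k) n) (S := S)
      hik.le hk hd hda h2 (hdisj.subset fun b hb => (mem_filter.1 (mem_coe.1 hb)).1)
      (fun b hb => hO b (mem_filter.1 hb).1)
      fun b hb => by
        obtain ⟨hbO, hns⟩ := mem_filter.1 hb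
        obtain ⟨j, hj, hj'⟩ := not_subset.1 hns
        have h1 := hU b hbO hj
        rw [mem_block] at h1 hj'
        exact ⟨j, hj, mem_block.2 (by omega)⟩
    rw [← sum_filter_add_sum_filter_not O (fun b => S b ⊆ block n (nfdStart d s k) n) d]
    linarith
  push Not at h2
  obtain ⟨c, hic, hck, h3⟩ := h2
  have hc3 : nfdStart d s c + 3 ≤ nfdStart d s (c + 1) := h3
  have hB := sum_le_of_three_items hik.le hk hd hs hda hsa hfill hic hck hc3 hdisj hO hU hcov
  set R := ∑ j ∈ block n (nfdStart d s k) n, s j with hR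
  have hmin : min (d c / 2 - d ⟨k, hk⟩) 0 ≤ d c / 2 - d ⟨k, hk⟩ := min_le_left _ _
  have hmin0 : min (d c / 2 - d ⟨k, hk⟩) 0 ≤ 0 := min_le_right _ _
  have hcG : c ∈ block m i k := mem_block.2 ⟨hic, hck⟩
  have hδ : ∀ b : Fin m, (b : ℕ) < k → d ⟨k, hk⟩ ≤ d b := fun b hb => hda (Fin.le_def.2 hb.le)
  -- it suffices that `c` earns at most half of the profit of the phase
  have hhalf : d c ≤ (∑ b ∈ block m i k, d b) / 2 →
      ∑ b ∈ O, d b ≤ 9 / 4 * (∑ b ∈ block m i k, d b + N) := fun h => by linarith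
  rcases (show i + 1 = k ∨ i + 2 = k ∨ i + 3 ≤ k by omega) with hg | hg | hg
  · subst hg
    obtain rfl : i = (c : ℕ) := by omega
    rw [sum_block_succ d le_rfl c.2, sum_block_self, zero_add]
    exact sum_le_of_single_phase rfl hk hd hs hda hsa (hfill c hic hck) hc3
      hrest hdisj hO hU hcov he heN hlow hind
  · subst hg
    have hD : ∑ b ∈ block m i (i + 2), d b = d ⟨i, by omega⟩ + d ⟨i + 1, by omega⟩ := by
      rw [sum_block_succ d (by omega) (by omega), sum_block_succ d le_rfl (by omega),
        sum_block_self, zero_add]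
    have h12 : d ⟨i + 1, by omega⟩ ≤ d ⟨i, by omega⟩ := hda (Fin.le_def.2 (by simp))
    rcases (show (c : ℕ) = i ∨ (c : ℕ) = i + 1 by omega) with hci | hci
    · -- the last items of both bins have size at most half of the first demand
      have hOT := sum_demand_le_sum_size hs hdisj hU hcov
      rw [← sum_block_add s (nfdStart_mono hik.le) (nfdStart_le _)] at hOT
      have h5 := sum_block_le_of_fills (d := d) (s := s) hik.le hk.le s
        (fun b => d b + d ⟨i, by omega⟩ / 2) fun b hb hb' => by
          obtain ⟨l, hl, hl', hlt, hsum⟩ := (hfill b hb hb').exists_last (hd b)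
          rw [hsum]
          have h6 : 2 * s l ≤ d c := last_le_half (hd c) hsa (hfill c hic hck) hc3 (by
            rw [← hl']
            exact nfdStart_mono (by omega))
          rw [show c = ⟨i, by omega⟩ from Fin.ext hci] at h6
          linarith
      have hcard : (#(block m i (i + 2)) : ℝ) ≤ 2 := by
        have := card_block_le (n := m) i (i + 2)
        exact_mod_cast (by omega : #(block m i (i + 2)) ≤ 2)
      rw [sum_add_distrib, sum_const, nsmul_eq_mul] at h5
      have h7 := hδ ⟨i + 1, by omega⟩ (by simp only; omega)
      have h8 := hd ⟨i, by omega⟩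
      nlinarith
    · rw [show c = ⟨i + 1, by omega⟩ from Fin.ext hci] at hhalf
      apply hhalf
      linarith
  · by_cases hhalf' : d c ≤ (∑ b ∈ block m i k, d b) / 2
    · exact hhalf hhalf'
    · have hsum : ∑ b ∈ block m i k, d b = d c + ∑ b ∈ (block m i k).erase c, d b :=
        (add_sum_erase _ _ hcG).symm
      have hcard : 2 ≤ #((block m i k).erase c) := by
        have hsub : ({⟨i, by omega⟩, ⟨i + 1, by omega⟩, ⟨i + 2, by omega⟩} : Finset (Fin m)) ⊆
            block m i k := by
          intro b hb
          simp only [mem_insert, mem_singleton, Fin.ext_iff] at hb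
          rw [mem_block]
          omega
        have h6 := card_le_card hsub
        rw [card_eq_three.2 ⟨_, _, _, by simp, by simp, by simp, rfl⟩] at h6
        rw [card_erase_of_mem hcG]
        omega
      have h7 : #((block m i k).erase c) • d ⟨k, hk⟩ ≤ ∑ b ∈ (block m i k).erase c, d b :=
        card_nsmul_le_sum _ _ _ fun b hb => hδ b (mem_block.1 (mem_of_mem_erase hb)).2
      rw [nsmul_eq_mul] at h7
      have h8 : (2 : ℝ) ≤ #((block m i k).erase c) := mod_cast hcard
      have h9 := hd ⟨k, hk⟩
      nlinarith

end PhaseBound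

section Guarantee

/-! ### The approximation guarantee -/

variable {m n : ℕ} {d : Fin m → ℝ} {s : Fin n → ℝ}

open Classical in
/-- The profit that Next Fit Decreasing earns with the bins from position `i` on. -/
noncomputable def gain (d : Fin m → ℝ) (s : Fin n → ℝ) (i : ℕ) : ℝ :=
  ∑ b ∈ univ.filter fun b : Fin m => i ≤ (b : ℕ) ∧ Fills d s b, d b

theorem gain_nonneg (hd : ∀ b, 0 < d b) (i : ℕ) : 0 ≤ gain d s i :=
  sum_nonneg fun b _ => (hd b).le

theorem le_gain (hd : ∀ b, 0 < d b) {b : Fin m} (h : Fills d s b) {i : ℕ} (hi : i ≤ b) :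
    d b ≤ gain d s i :=
  single_le_sum (f := d) (fun b _ => (hd b).le) (by simp [h, hi])

theorem sum_block_add_gain_le (hd : ∀ b, 0 < d b) {i k k' : ℕ} (hik : i ≤ k) (hkk' : k ≤ k')
    (hfill : ∀ b : Fin m, i ≤ b → (b : ℕ) < k → Fills d s b) :
    ∑ b ∈ block m i k, d b + gain d s k' ≤ gain d s i := by
  classical
  rw [gain, gain, ← sum_union]
  · refine sum_le_sum_of_subset_of_nonneg (fun b hb => ?_) fun b _ _ => (hd b).le
    simp only [mem_union, mem_block, mem_filter, mem_univ, true_and] at hb ⊢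
    rcases hb with hb | hb
    · exact ⟨hb.1, hfill b hb.1 hb.2⟩
    · exact ⟨by omega, hb.2⟩
  · rw [disjoint_left]
    intro b hb hb'
    simp only [mem_block, mem_filter, mem_univ, true_and] at hb hb'
    omega

theorem nfdStart_eq_of_not_fills {k k' : ℕ} (hkk' : k ≤ k')
    (hk' : k' ≤ m) (h : ∀ b : Fin m, k ≤ b → (b : ℕ) < k' → ¬ Fills d s b) :
    nfdStart d s k' = nfdStart d s k := by
  induction k', hkk' using Nat.le_induction with
  | base => rfl
  | succ k' hkk' ih =>
    rw [← ih (by omega) fun b h1 h2 => h b h1 (by omega)]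
    exact nfdStart_succ_of_not_fills (i := ⟨k', hk'⟩) (h _ hkk' (by simp))

theorem rest_lt_of_not_fills (hd : ∀ b, 0 < d b) {b : Fin m} (h : ¬ Fills d s b) :
    ∑ j ∈ block n (nfdStart d s b) n, s j < d b := by
  by_contra! hle
  refine h ⟨?_, hle⟩
  by_contra! hn
  rw [le_antisymm (nfdStart_le _) hn, sum_block_self] at hle
  exact (hd b).not_ge hle

/-- The first position from `i` on at which `P` fails (or `m` if there is none). -/
theorem exists_first (P : Fin m → Prop) {i : ℕ} (hi : i ≤ m) :
    ∃ k, i ≤ k ∧ k ≤ m ∧ (∀ b : Fin m, i ≤ b → (b : ℕ) < k → P b) ∧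
      ∀ h : k < m, ¬ P ⟨k, h⟩ := by
  classical
  have hex : ∃ k, i ≤ k ∧ ∀ h : k < m, ¬ P ⟨k, h⟩ := ⟨m, hi, fun h => (lt_irrefl _ h).elim⟩
  have hle : Nat.find hex ≤ m := Nat.find_min' hex ⟨hi, fun h => (lt_irrefl _ h).elim⟩
  refine ⟨Nat.find hex, (Nat.find_spec hex).1, hle, fun b hb hb' => ?_, (Nat.find_spec hex).2⟩
  by_contra hP
  exact Nat.find_min hex hb' ⟨hb, fun _ => hP⟩

/-- At every moment, the bins and items that are left admit no solution that earns more than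
`9 / 4` times the profit Next Fit Decreasing makes from now on. -/
theorem sum_le_gain (hd : ∀ b, 0 < d b) (hs : ∀ j, 0 ≤ s j) (hda : Antitone d) (hsa : Antitone s)
    {S : Fin m → Finset (Fin n)} (i : ℕ) (hi : i ≤ m) (O : Finset (Fin m))
    (hdisj : (O : Set (Fin m)).PairwiseDisjoint S) (hO : ∀ b ∈ O, i ≤ b)
    (hU : ∀ b ∈ O, S b ⊆ block n (nfdStart d s i) n) (hcov : ∀ b ∈ O, d b ≤ ∑ j ∈ S b, s j) :
    ∑ b ∈ O, d b ≤ 9 / 4 * gain d s i := by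
  induction hr : m - i using Nat.strong_induction_on generalizing i O with
  | _ r ih =>
  obtain ⟨k, hik, hkm, hfill, hk⟩ := exists_first (Fills d s) hi
  have hg := gain_nonneg (s := s) hd i
  rcases hkm.eq_or_lt with rfl | hkm
  · -- no bin is skipped any more
    have h1 := sum_block_add_gain_le hd hik le_rfl hfill
    have h2 : ∑ b ∈ O, d b ≤ ∑ b ∈ block k i k, d b :=
      sum_le_sum_of_subset_of_nonneg (fun b hb => mem_block.2 ⟨hO b hb, b.2⟩)
        fun b _ _ => (hd b).le
    have h3 := gain_nonneg (s := s) hd k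
    linarith
  have hrest := rest_lt_of_not_fills hd (hk hkm)
  simp only at hrest
  -- `k'` is the first bin after `k` that gets covered
  obtain ⟨k', hkk', hkm', hskip, hk'⟩ := exists_first (fun b => ¬ Fills d s b) hkm.le
  have hst := nfdStart_eq_of_not_fills hkk' hkm' hskip
  have hlt : k < k' := by
    rcases hkk'.eq_or_lt with rfl | h
    · exact (hk' hkm (hk hkm)).elim
    · exact h
  have hlow : ∀ b ∈ O, d b ≤ ∑ j ∈ block n (nfdStart d s k) n, s j → k' ≤ b := by
    intro b hb hle
    by_contra! hbk'
    rcases lt_or_ge (b : ℕ) k with hbk | hbk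
    · have := hda (Fin.le_def.2 hbk.le : b ≤ ⟨k, hkm⟩)
      linarith
    · have h1 := rest_lt_of_not_fills hd (hskip b hbk hbk')
      rw [nfdStart_eq_of_not_fills hbk b.2.le fun c h1 h2 => hskip c h1 (by omega)] at h1
      linarith
  have hind : ∀ O' ⊆ O, (∀ b ∈ O', S b ⊆ block n (nfdStart d s k) n) →
      ∑ b ∈ O', d b ≤ 9 / 4 * gain d s k' := by
    intro O' hO' hS
    refine ih (m - k') (by omega) k' hkm' O' (hdisj.subset (by exact_mod_cast hO'))
      (fun b hb => hlow b (hO' hb) ?_) (fun b hb => by rw [hst]; exact hS b hb)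
      (fun b hb => hcov b (hO' hb)) rfl
    exact (hcov b (hO' hb)).trans (sum_le_sum_of_subset_of_nonneg (hS b hb) fun j _ _ => hs j)
  rcases hik.eq_or_lt with rfl | hik
  · have h1 := hind O subset_rfl hU
    have h2 := sum_block_add_gain_le (s := s) hd le_rfl hkk' hfill
    rw [sum_block_self] at h2
    linarith
  have h2 := sum_block_add_gain_le hd hik.le hkk' hfill
  obtain ⟨e, he, heN, hle⟩ : ∃ e, 0 ≤ e ∧ e ≤ gain d s k' ∧
      ∀ b ∈ O, d b ≤ ∑ j ∈ block n (nfdStart d s k) n, s j → d b ≤ e := by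
    rcases hkm'.eq_or_lt with rfl | hkm'
    · exact ⟨0, le_rfl, gain_nonneg hd _, fun b hb h => absurd (hlow b hb h) b.2.not_ge⟩
    · exact ⟨d ⟨k', hkm'⟩, (hd _).le, le_gain hd (not_not.1 (hk' hkm')) le_rfl,
        fun b hb h => hda (Fin.le_def.2 (hlow b hb h))⟩
  have h3 := sum_le_of_phase hik hkm hd hs hda hsa hfill hrest hdisj hO hU hcov he heN hle hind
  linarith

/-! ### Sorting and renaming -/

theorem fills_iff_covered (hd : ∀ b, 0 < d b) (i : Fin m) :
    d i ≤ ∑ j ∈ nfdSorted d s i, s j ↔ Fills d s i := by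
  refine ⟨fun h => ?_, Fills.covered⟩
  by_contra hf
  rw [nfdSorted, nfdStart_succ_of_not_fills hf, sum_block_self] at h
  exact (hd i).not_ge h

theorem profit_nfdSorted (hd : ∀ b, 0 < d b) : profit d s (nfdSorted d s) = gain d s 0 := by
  classical
  rw [profit, gain]
  simp only [fills_iff_covered hd, Nat.zero_le, true_and]

theorem isSolution_nfdSorted : IsSolution (nfdSorted d s) := by
  have key : ∀ i i' : Fin m, i < i' → Disjoint (nfdSorted d s i) (nfdSorted d s i') := by
    intro i i' h
    rw [disjoint_left]
    intro l h1 h2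
    rw [nfdSorted, mem_block] at h1 h2
    have := nfdStart_mono (d := d) (s := s) (show (i : ℕ) + 1 ≤ i' from h)
    omega
  intro i i' h
  rcases lt_or_gt_of_ne h with h | h
  · exact key i i' h
  · exact (key i' i h).symm

theorem IsSolution.comp_map {S : Fin m → Finset (Fin n)} (hS : IsSolution S)
    (β : Equiv.Perm (Fin m)) (τ : Equiv.Perm (Fin n)) :
    IsSolution fun i => (S (β i)).map τ.toEmbedding := fun _ _ h =>
  (disjoint_map _).2 (hS _ _ (β.injective.ne h))

theorem profit_comp_map {S T : Fin m → Finset (Fin n)} (β : Equiv.Perm (Fin m))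
    (τ : Equiv.Perm (Fin n)) (h : ∀ i, S (β i) = (T i).map τ.toEmbedding) :
    profit d s S = profit (d ∘ β) (s ∘ τ) T := by
  classical
  rw [profit, profit, sum_filter, sum_filter]
  refine (Equiv.sum_comp β _).symm.trans (sum_congr rfl fun i _ => ?_)
  rw [h, sum_map]
  rfl

theorem exists_perm_antitone (d : Fin m → ℝ) : ∃ β : Equiv.Perm (Fin m), Antitone (d ∘ β) :=
  ⟨Tuple.sort fun i => -d i, fun i j h => by
    have := Tuple.monotone_sort (fun i => -d i) h
    simpa using this⟩

theorem exists_isNFD (d : Fin m → ℝ) (s : Fin n → ℝ) : ∃ S, IsNFD d s S := by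
  obtain ⟨β, hβ⟩ := exists_perm_antitone d
  obtain ⟨τ, hτ⟩ := exists_perm_antitone s
  exact ⟨fun i => (nfdSorted (d ∘ β) (s ∘ τ) (β.symm i)).map τ.toEmbedding, β, τ, hβ, hτ,
    fun i => by simp only [Equiv.symm_apply_apply]⟩

theorem IsNFD.isSolution {S : Fin m → Finset (Fin n)} (h : IsNFD d s S) : IsSolution S := by
  obtain ⟨β, τ, -, -, h⟩ := h
  have : S = fun i => (nfdSorted (d ∘ β) (s ∘ τ) (β.symm i)).map τ.toEmbedding := by
    funext i
    rw [← h, Equiv.apply_symm_apply]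
  rw [this]
  exact isSolution_nfdSorted.comp_map β.symm τ

theorem opt_le {x : ℝ} (h : ∀ S : Fin m → Finset (Fin n), IsSolution S → profit d s S ≤ x) :
    opt d s ≤ x := by
  refine csSup_le ⟨_, fun _ => ∅, fun _ _ _ => disjoint_empty_left _, rfl⟩ ?_
  rintro p ⟨S, hS, rfl⟩
  exact h S hS

theorem le_opt {S : Fin m → Finset (Fin n)} (hS : IsSolution S) : profit d s S ≤ opt d s := by
  refine le_csSup (Set.Finite.bddAbove ?_) ⟨S, hS, rfl⟩
  refine (Set.finite_range (profit d s)).subset ?_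
  rintro p ⟨S, -, rfl⟩
  exact ⟨S, rfl⟩

theorem IsNFD.opt_le_profit (hd : ∀ b, 0 < d b) (hs : ∀ j, 0 ≤ s j)
    {S : Fin m → Finset (Fin n)} (h : IsNFD d s S) : opt d s ≤ 9 / 4 * profit d s S := by
  classical
  obtain ⟨β, τ, hβ, hτ, h⟩ := h
  have hd' : ∀ b, 0 < (d ∘ β) b := fun b => hd _
  rw [profit_comp_map β τ h, profit_nfdSorted hd']
  refine opt_le fun S' hS' => ?_
  have hS'' := hS'.comp_map β τ.symm
  rw [profit_comp_map (T := fun i => (S' (β i)).map τ.symm.toEmbedding) β τ fun i => by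
    rw [map_map]
    ext j
    simp, profit]
  refine sum_le_gain hd' (fun j => hs _) hβ hτ 0 (Nat.zero_le _) _
    (fun b _ b' _ hne => hS'' b b' hne) (fun _ _ => Nat.zero_le _) (fun b _ j _ => ?_)
    fun b hb => (mem_filter.1 hb).2
  rw [mem_block]
  exact ⟨by simp [nfdStart], j.2⟩

end Guarantee

/-! ### The tight instances -/

theorem comp_eq_of_antitone {m : ℕ} {d : Fin m → ℝ} (hd : Antitone d) {β : Equiv.Perm (Fin m)}
    (hβ : Antitone (d ∘ β)) : d ∘ β = d :=
  Tuple.unique_antitone (τ := Equiv.refl _) hβ hd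

section Tight

variable {ε : ℝ}

/-- The demands of the tight instances. -/
noncomputable def tightDemand (ε : ℝ) : Fin 4 → ℝ := ![4, 3 - 2 * ε, 3 - 2 * ε, 3 - 2 * ε]

/-- The sizes of the tight instances. -/
noncomputable def tightSize (ε : ℝ) : Fin 6 → ℝ :=
  ![2 - ε, 2 - ε, 2 - ε, 1 - ε, 1 - ε, 1 - ε]

theorem tightDemand_pos (h1 : ε < 2 / 3) (i : Fin 4) : 0 < tightDemand ε i := by
  fin_cases i <;> simp [tightDemand] <;> linarith

theorem tightSize_pos (h1 : ε < 2 / 3) (j : Fin 6) : 0 < tightSize ε j := by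
  fin_cases j <;> simp [tightSize] <;> linarith

theorem tightDemand_antitone (h0 : 0 < ε) : Antitone (tightDemand ε) := by
  rw [Fin.antitone_iff_succ_le]
  intro i
  fin_cases i <;> simp [tightDemand]
  linarith

theorem tightSize_antitone : Antitone (tightSize ε) := by
  rw [Fin.antitone_iff_succ_le]
  intro i
  fin_cases i <;> simp [tightSize]

theorem sum_block_tightSize (a b : ℕ) : ∑ l ∈ block 6 a b, tightSize ε l =
    ∑ l : Fin 6, if a ≤ (l : ℕ) ∧ (l : ℕ) < b then tightSize ε l else 0 := by
  rw [block, sum_filter]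

theorem opt_tight (h1 : ε < 2 / 3) : opt (tightDemand ε) (tightSize ε) = 9 - 6 * ε := by
  classical
  apply le_antisymm
  · refine opt_le fun S hS => ?_
    refine (sum_demand_le_sum_size (U := univ) (fun j => (tightSize_pos h1 j).le)
      (fun b _ b' _ hne => hS b b' hne) (fun _ _ => subset_univ _)
      fun b hb => (mem_filter.1 hb).2).trans_eq ?_
    simp [tightSize, Fin.sum_univ_succ]
    ring
  · let S : Fin 4 → Finset (Fin 6) := ![∅, {0, 3}, {1, 4}, {2, 5}]
    have hS : IsSolution S := by
      unfold IsSolution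
      decide
    refine le_trans (le_of_eq ?_) (le_opt hS)
    have c0 : ¬ tightDemand ε 0 ≤ ∑ j ∈ S 0, tightSize ε j := by
      simp [S, tightDemand]
    have c : ∀ i : Fin 4, i ≠ 0 → tightDemand ε i ≤ ∑ j ∈ S i, tightSize ε j := by
      intro i hi
      fin_cases i <;> simp [S, tightDemand, tightSize] at hi ⊢ <;> linarith
    rw [profit, sum_filter, Fin.sum_univ_four, if_neg c0, if_pos (c 1 (by decide)),
      if_pos (c 2 (by decide)), if_pos (c 3 (by decide))]
    simp [tightDemand]
    ring

theorem profit_nfdSorted_tight (h0 : 0 < ε) (h1 : ε < 2 / 3) :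
    profit (tightDemand ε) (tightSize ε) (nfdSorted (tightDemand ε) (tightSize ε)) = 4 := by
  classical
  set d := tightDemand ε with hd
  set s := tightSize ε with hs
  have st0 : nfdStart d s 0 = 0 := rfl
  have f0 : Fills d s 0 := by
    refine ⟨by simp [st0], ?_⟩
    rw [Fin.val_zero, st0, hs, sum_block_tightSize]
    simp [hd, tightDemand, tightSize, Fin.sum_univ_succ]
    linarith
  have st1 : nfdStart d s 1 = 3 := by
    have h2 := f0.covered
    have h3 : ∀ b < nfdStart d s 1, ∑ l ∈ block 6 0 b, s l < d 0 := fun b hb =>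
      f0.lt_of_lt (tightDemand_pos h1 0) (Nat.zero_le b) hb
    simp only [Fin.val_zero, zero_add, st0] at h2
    apply le_antisymm
    · by_contra! hlt
      have h5 := h3 3 hlt
      rw [hs, sum_block_tightSize] at h5
      simp [hd, tightDemand, tightSize, Fin.sum_univ_succ] at h5
      linarith
    · by_contra! hlt
      have h5 : d 0 ≤ ∑ l ∈ block 6 0 2, s l := h2.trans
        (sum_le_sum_of_subset_of_nonneg (fun l hl => by rw [mem_block] at hl ⊢; omega)
          fun j _ _ => (tightSize_pos h1 j).le)
      rw [hs, sum_block_tightSize] at h5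
      simp [hd, tightDemand, tightSize, Fin.sum_univ_succ] at h5
      linarith
  have hnot : ∀ i : Fin 4, i ≠ 0 → nfdStart d s i = 3 → ¬ Fills d s i := by
    intro i hi h3 hf
    have h5 := hf.2
    rw [h3, hs, sum_block_tightSize] at h5
    have h6 : d i = 3 - 2 * ε := by
      fin_cases i <;> simp [hd, tightDemand] at hi ⊢
    rw [h6] at h5
    simp [tightSize, Fin.sum_univ_succ] at h5
    linarith
  have n1 := hnot 1 (by decide) st1
  have st2 : nfdStart d s 2 = 3 := (nfdStart_succ_of_not_fills n1).trans st1
  have n2 := hnot 2 (by decide) st2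
  have st3 : nfdStart d s 3 = 3 := (nfdStart_succ_of_not_fills n2).trans st2
  have n3 := hnot 3 (by decide) st3
  have hp : profit d s (nfdSorted d s) = gain d s 0 := profit_nfdSorted (tightDemand_pos h1)
  rw [hp, gain, sum_filter, Fin.sum_univ_four, if_pos ⟨Nat.zero_le _, f0⟩,
    if_neg fun h => n1 h.2, if_neg fun h => n2 h.2, if_neg fun h => n3 h.2]
  simp [hd, tightDemand]

theorem IsNFD.profit_tight (h0 : 0 < ε) (h1 : ε < 2 / 3) {S : Fin 4 → Finset (Fin 6)}
    (h : IsNFD (tightDemand ε) (tightSize ε) S) :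
    profit (tightDemand ε) (tightSize ε) S = 4 := by
  obtain ⟨β, τ, hβ, hτ, h⟩ := h
  rw [profit_comp_map β τ h, comp_eq_of_antitone (tightDemand_antitone h0) hβ,
    comp_eq_of_antitone tightSize_antitone hτ]
  exact profit_nfdSorted_tight h0 h1

end Tight

/-! ### Total correctness with time bounds -/

/-- Started in `σ`, the program `P` halts after at most `T` steps in a memory that satisfies `Q`. -/
def Reaches (P : Prog) (σ : Store) (T : ℕ) (Q : Store → Prop) : Prop :=
  ∃ t σ', Runs P σ t σ' ∧ t ≤ T ∧ Q σ'

/-- The memory after an assignment to a register. -/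
def Store.setReg (σ : Store) (x v : ℕ) : Store :=
  { σ with reg := Function.update σ.reg x v }

/-- The memory after an assignment to a cell of an array of natural numbers. -/
def Store.setIdx (σ : Store) (a k v : ℕ) : Store :=
  { σ with idx := Function.update σ.idx a (Function.update (σ.idx a) k v) }

/-- The memory after an assignment to a cell of an array of real numbers. -/
noncomputable def Store.setVal (σ : Store) (a k : ℕ) (v : ℝ) : Store :=
  { σ with val := Function.update σ.val a (Function.update (σ.val a) k v) }

section Store

variable (σ : Store) (x y a b k p v : ℕ) (r : ℝ)

@[simp] theorem Store.setReg_reg : (σ.setReg x v).reg y = if y = x then v else σ.reg y :=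
  Function.update_apply _ _ _ _

@[simp] theorem Store.setReg_idx : (σ.setReg x v).idx = σ.idx := rfl

@[simp] theorem Store.setReg_val : (σ.setReg x v).val = σ.val := rfl

@[simp] theorem Store.setIdx_reg : (σ.setIdx a k v).reg = σ.reg := rfl

@[simp] theorem Store.setIdx_idx :
    (σ.setIdx a k v).idx b p = if b = a ∧ p = k then v else σ.idx b p := by
  by_cases h : b = a
  · subst h
    simp [Store.setIdx, Function.update_apply]
  · simp [Store.setIdx, h]

@[simp] theorem Store.setIdx_val : (σ.setIdx a k v).val = σ.val := rfl

@[simp] theorem Store.setVal_reg : (σ.setVal a k r).reg = σ.reg := rfl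

@[simp] theorem Store.setVal_idx : (σ.setVal a k r).idx = σ.idx := rfl

@[simp] theorem Store.setVal_val :
    (σ.setVal a k r).val b p = if b = a ∧ p = k then r else σ.val b p := by
  by_cases h : b = a
  · subst h
    simp [Store.setVal, Function.update_apply]
  · simp [Store.setVal, h]

end Store

namespace Reaches

variable {P P' : Prog} {b : Test} {σ : Store} {T T' : ℕ} {Q Q' : Store → Prop}

theorem mono (h : Reaches P σ T Q) (hT : T ≤ T') (hQ : ∀ σ', Q σ' → Q' σ') :
    Reaches P σ T' Q' := by
  obtain ⟨t, σ', h1, h2, h3⟩ := h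
  exact ⟨t, σ', h1, h2.trans hT, hQ _ h3⟩

theorem skip (h : Q σ) : Reaches .skip σ 1 Q := ⟨1, σ, .skip σ, le_rfl, h⟩

theorem setReg {x : ℕ} {e : NExp} (h : Q (σ.setReg x (e.eval σ))) :
    Reaches (.setReg x e) σ (e.cost + 1) Q := ⟨_, _, .setReg σ x e, le_rfl, h⟩

theorem setIdx {a : ℕ} {k e : NExp} (h : Q (σ.setIdx a (k.eval σ) (e.eval σ))) :
    Reaches (.setIdx a k e) σ (k.cost + e.cost + 1) Q := ⟨_, _, .setIdx σ a k e, le_rfl, h⟩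

theorem setVal {a : ℕ} {k : NExp} {e : RExp} (h : Q (σ.setVal a (k.eval σ) (e.eval σ))) :
    Reaches (.setVal a k e) σ (k.cost + e.cost + 1) Q := ⟨_, _, .setVal σ a k e, le_rfl, h⟩

theorem seq (h : Reaches P σ T fun σ' => Reaches P' σ' T' Q) :
    Reaches (.seq P P') σ (T + T' + 1) Q := by
  obtain ⟨t, σ', h1, h2, t', σ'', h3, h4, h5⟩ := h
  exact ⟨_, σ'', .seq h1 h3, by omega, h5⟩

theorem branch (h : b.Holds σ → Reaches P σ T Q) (h' : ¬ b.Holds σ → Reaches P' σ T' Q) :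
    Reaches (.branch b P P') σ (b.cost + max T T' + 1) Q := by
  by_cases hb : b.Holds σ
  · obtain ⟨t, σ', h1, h2, h3⟩ := h hb
    exact ⟨_, σ', .branchTrue hb h1, by omega, h3⟩
  · obtain ⟨t, σ', h1, h2, h3⟩ := h' hb
    exact ⟨_, σ', .branchFalse hb h1, by omega, h3⟩

/-- The rule for loops: `I` is an invariant, and each iteration pays for itself by a decrease of
the potential `μ`, which also covers the final test. -/
theorem loop (I : Store → Prop) (μ : Store → ℕ) (h0 : I σ)
    (hstep : ∀ σ, I σ → b.Holds σ → ∃ T, Reaches P σ T fun σ' =>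
      I σ' ∧ b.cost + T + 1 + μ σ' ≤ μ σ)
    (hexit : ∀ σ, I σ → ¬ b.Holds σ → b.cost + 1 ≤ μ σ ∧ Q σ) :
    Reaches (.loop b P) σ (μ σ) Q := by
  induction hN : μ σ using Nat.strong_induction_on generalizing σ with
  | _ N ih =>
  subst hN
  by_cases hb : b.Holds σ
  · obtain ⟨T, t, σ', h1, h2, h3, h4⟩ := hstep σ h0 hb
    obtain ⟨u, σ'', h5, h6, h7⟩ := ih (μ σ') (by omega) h3 rfl
    exact ⟨_, σ'', .loopStep hb h1 h5, by omega, h7⟩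
  · obtain ⟨h1, h2⟩ := hexit σ h0 hb
    exact ⟨_, σ, .loopStop hb, h1, h2⟩

end Reaches

/-- `σ'` agrees with `σ` except in the registers from `r` on and the natural number array `a`. -/
structure Keeps (a r : ℕ) (σ σ' : Store) : Prop where
  val : σ'.val = σ.val
  idx : ∀ b, b ≠ a → σ'.idx b = σ.idx b
  reg : ∀ x, x < r → σ'.reg x = σ.reg x

theorem Keeps.refl (a r : ℕ) (σ : Store) : Keeps a r σ σ := ⟨rfl, fun _ _ => rfl, fun _ _ => rfl⟩

theorem Keeps.trans {a r : ℕ} {σ σ' σ'' : Store} (h : Keeps a r σ σ') (h' : Keeps a r σ' σ'') :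
    Keeps a r σ σ'' :=
  ⟨h'.val.trans h.val, fun b hb => (h'.idx b hb).trans (h.idx b hb),
    fun x hx => (h'.reg x hx).trans (h.reg x hx)⟩

theorem Keeps.mono {a r r' : ℕ} {σ σ' : Store} (h : Keeps a r σ σ') (hr : r' ≤ r) :
    Keeps a r' σ σ' := ⟨h.val, h.idx, fun x hx => h.reg x (hx.trans_le hr)⟩

theorem Keeps.setReg {a r : ℕ} {σ σ' : Store} (h : Keeps a r σ σ') {x : ℕ} (hx : r ≤ x) (v : ℕ) :
    Keeps a r σ (σ'.setReg x v) :=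
  ⟨h.val, h.idx, fun y hy => by rw [Store.setReg_reg, if_neg (by omega), h.reg y hy]⟩

theorem Keeps.setIdx {a r : ℕ} {σ σ' : Store} (h : Keeps a r σ σ') (k v : ℕ) :
    Keeps a r σ (σ'.setIdx a k v) :=
  ⟨h.val, fun b hb => by
    funext p
    rw [Store.setIdx_idx, if_neg fun hc => hb hc.1, h.idx b hb], h.reg⟩

/-! ### Segments of arrays -/

/-- The list of the `len` cells of `f` from `lo` on. -/
def seg (f : ℕ → ℕ) (lo len : ℕ) : List ℕ := (List.range' lo len).map f

@[simp] theorem seg_zero (f : ℕ → ℕ) (lo : ℕ) : seg f lo 0 = [] := rfl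

theorem seg_succ (f : ℕ → ℕ) (lo len : ℕ) : seg f lo (len + 1) = f lo :: seg f (lo + 1) len := rfl

theorem seg_add (f : ℕ → ℕ) (lo k l : ℕ) : seg f lo (k + l) = seg f lo k ++ seg f (lo + k) l := by
  rw [seg, seg, seg, ← List.map_append, List.range'_append_1]

theorem seg_congr {f g : ℕ → ℕ} {lo len : ℕ} (h : ∀ p, lo ≤ p → p < lo + len → f p = g p) :
    seg f lo len = seg g lo len :=
  List.map_congr_left fun p hp => by
    rw [List.mem_range'_1] at hp
    exact h p hp.1 hp.2

@[simp] theorem length_seg (f : ℕ → ℕ) (lo len : ℕ) : (seg f lo len).length = len := by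
  simp [seg]

theorem seg_eq_cons {f : ℕ → ℕ} {i j : ℕ} (h : i < j) :
    seg f i (j - i) = f i :: seg f (i + 1) (j - (i + 1)) := by
  obtain ⟨l, rfl⟩ := Nat.exists_eq_add_of_lt h
  rw [show i + l + 1 - i = l + 1 by omega, show i + l + 1 - (i + 1) = l by omega, seg_succ]

/-! ### Merge sort -/

infixr:60 " ;; " => Prog.seq

/-- Comparison of two indices, for sorting by non-increasing key. -/
noncomputable def keyLe (key : ℕ → ℝ) (x y : ℕ) : Bool := decide (key y ≤ key x)

/-- One step of merging: the larger one of the first items of the two runs (which start at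
registers `13` and `15` and end before registers `14` and `16`) is moved to cell `17`. -/
def mergeStep (v a : ℕ) : Prog :=
  .branch (.both (.natLt (.reg 13) (.reg 14))
      (.neg (.both (.natLt (.reg 15) (.reg 16))
        (.realLt (.read v (.read a (.reg 13))) (.read v (.read a (.reg 15)))))))
    (.setIdx a (.reg 17) (.read a (.reg 13)) ;; .setReg 13 (.plus (.reg 13) (.const 1)))
    (.setIdx a (.reg 17) (.read a (.reg 15)) ;; .setReg 15 (.plus (.reg 15) (.const 1))) ;;
  .setReg 17 (.plus (.reg 17) (.const 1))

/-- Merging two adjacent runs. The output is at distance register `2` from the input. -/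
def mergeRuns (v a : ℕ) : Prog :=
  .loop (.natLt (.reg 17) (.plus (.reg 16) (.reg 2))) (mergeStep v a)

/-- The invariant is that the output so far, followed by the merge of what is left of the two runs,
is the merge of the two runs. The input lies before the output and stays intact. -/
theorem mergeRuns_spec {v a lo mid hi N : ℕ} {σ : Store} (hlm : lo ≤ mid) (hmh : mid ≤ hi)
    (hhN : hi ≤ lo + N)
    (h2 : σ.reg 2 = N) (h13 : σ.reg 13 = lo) (h14 : σ.reg 14 = mid) (h15 : σ.reg 15 = mid)
    (h16 : σ.reg 16 = hi) (h17 : σ.reg 17 = lo + N) :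
    Reaches (mergeRuns v a) σ (50 * (hi - lo) + 10) fun σ' =>
      Keeps a 13 σ σ' ∧ σ'.reg 17 = hi + N ∧ (∀ p, p < lo + N → σ'.idx a p = σ.idx a p) ∧
      seg (σ'.idx a) (lo + N) (hi - lo) =
        List.merge (seg (σ.idx a) lo (mid - lo)) (seg (σ.idx a) mid (hi - mid))
          (keyLe (σ.val v)) := by
  set f := σ.idx a with hf
  set key := σ.val v with hkey
  refine (Reaches.loop (fun τ => Keeps a 13 σ τ ∧ τ.reg 14 = mid ∧ τ.reg 16 = hi ∧
      (∀ p, p < lo + N → τ.idx a p = f p) ∧ ∃ i j, τ.reg 13 = i ∧ τ.reg 15 = j ∧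
        lo ≤ i ∧ i ≤ mid ∧ mid ≤ j ∧ j ≤ hi ∧ τ.reg 17 + mid = i + j + N ∧
        seg (τ.idx a) (lo + N) (i - lo + (j - mid)) ++
          List.merge (seg f i (mid - i)) (seg f j (hi - j)) (keyLe key) =
          List.merge (seg f lo (mid - lo)) (seg f mid (hi - mid)) (keyLe key))
    (fun τ => 50 * (hi + N - τ.reg 17) + 10) ?_ ?_ ?_).mono ?_ fun _ h => h
  · refine ⟨.refl _ _ _, h14, h16, fun _ _ => rfl, lo, mid, h13, h15, le_rfl, hlm, le_rfl, hmh,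
      by omega, ?_⟩
    simp
  · rintro τ ⟨hk, h14, h16, hlow, i, j, h13, h15, hli, him, hmj, hjh, h17, heq⟩ hb
    have hτ2 : τ.reg 2 = N := (hk.reg 2 (by omega)).trans h2
    have hv : τ.val = σ.val := hk.val
    simp only [Test.Holds, NExp.eval, h16, hτ2] at hb
    have hi' : τ.idx a i = f i ∨ ¬ i < mid := by
      by_cases h : i < mid
      · exact Or.inl (hlow i (by omega))
      · exact Or.inr h
    -- writing `x` behind the output appends it to the output list
    have hout : ∀ x, seg (fun p => if p = τ.reg 17 then x else τ.idx a p) (lo + N)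
        (i - lo + (j - mid) + 1) = seg (τ.idx a) (lo + N) (i - lo + (j - mid)) ++ [x] := by
      intro x
      rw [seg_add]
      congr 1
      · exact seg_congr fun p _ hp => if_neg (by omega)
      · rw [seg_succ, seg_zero, if_pos (by omega)]
    refine ⟨_, .seq (.branch (fun hb' => .seq (.setIdx (.setReg (.setReg ?_))))
      fun hb' => .seq (.setIdx (.setReg (.setReg ?_))))⟩
    · simp only [Test.Holds, NExp.eval, RExp.eval, h13, h14, h15, h16, hv] at hb'
      have h1 : i < mid := hb'.1
      rw [hlow i (by omega)] at hb'
      refine ⟨⟨(((hk.setIdx _ _).setReg (by omega) _).setReg (by omega) _), by simp [h14],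
        by simp [h16], ?_, i + 1, j, by simp [NExp.eval, h13], by simp [h15], by omega, by omega,
        by omega, by omega, by simp [NExp.eval]; omega, ?_⟩, ?_⟩
      · intro p hp
        simp only [Store.setReg_idx, Store.setIdx_idx, NExp.eval]
        rw [if_neg (by omega), hlow p hp]
      · have h3 := hout (f i)
        rw [show i + 1 - lo + (j - mid) = i - lo + (j - mid) + 1 by omega, ← heq,
          seg_eq_cons h1]
        have h4 : ∀ σ₁ : Store, σ₁.idx a = (fun p => if p = τ.reg 17 then f i else τ.idx a p) →
          seg (σ₁.idx a) (lo + N) (i - lo + (j - mid) + 1) = _ := fun σ₁ h => (h ▸ h3)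
        rw [h4 _ (by
          funext p
          simp [NExp.eval, h13, hlow i (by omega : i < lo + N)]), List.append_assoc]
        congr 1
        by_cases h5 : j < hi
        · rw [seg_eq_cons h5, List.cons_merge_cons_pos]
          · rfl
          · have h6 := hb'.2
            rw [hlow j (by omega)] at h6
            simp only [not_and, not_lt] at h6
            simpa [keyLe] using h6 h5
        · rw [show hi - j = 0 by omega]
          simp
      · simp [NExp.eval, NExp.cost, Test.cost, RExp.cost]
        omega
    · simp only [Test.Holds, NExp.eval, RExp.eval, h13, h14, h15, h16, hv] at hb'
      have h1 : j < hi := by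
        by_contra h
        exact hb' ⟨by omega, fun h' => h h'.1⟩
      rw [hlow j (by omega)] at hb'
      refine ⟨⟨(((hk.setIdx _ _).setReg (by omega) _).setReg (by omega) _), by simp [h14],
        by simp [h16], ?_, i, j + 1, by simp [h13], by simp [NExp.eval, h15], by omega, by omega,
        by omega, by omega, by simp [NExp.eval]; omega, ?_⟩, ?_⟩
      · intro p hp
        simp only [Store.setReg_idx, Store.setIdx_idx, NExp.eval]
        rw [if_neg (by omega), hlow p hp]
      · have h3 := hout (f j)
        rw [show i - lo + (j + 1 - mid) = i - lo + (j - mid) + 1 by omega, ← heq,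
          seg_eq_cons h1]
        have h4 : ∀ σ₁ : Store, σ₁.idx a = (fun p => if p = τ.reg 17 then f j else τ.idx a p) →
          seg (σ₁.idx a) (lo + N) (i - lo + (j - mid) + 1) = _ := fun σ₁ h => (h ▸ h3)
        rw [h4 _ (by
          funext p
          simp [NExp.eval, h15, hlow j (by omega : j < lo + N)]), List.append_assoc]
        congr 1
        by_cases h5 : i < mid
        · rw [seg_eq_cons h5, List.cons_merge_cons_neg]
          · rfl
          · rw [hlow i (by omega)] at hb'
            have h6 : key (f i) < key (f j) := by
              by_contra h
              exact hb' ⟨h5, fun h' => h h'.2⟩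
            simpa [keyLe] using h6
        · rw [show mid - i = 0 by omega]
          simp
      · simp [NExp.eval, NExp.cost, Test.cost, RExp.cost]
        omega
  · rintro τ ⟨hk, h14, h16, hlow, i, j, h13, h15, hli, him, hmj, hjh, h17, heq⟩ hb
    have hτ2 : τ.reg 2 = N := (hk.reg 2 (by omega)).trans h2
    simp only [Test.Holds, NExp.eval, h16, hτ2] at hb
    obtain rfl : i = mid := by omega
    obtain rfl : j = hi := by omega
    refine ⟨by simp [NExp.cost, Test.cost], hk, by omega, hlow, ?_⟩
    rw [← heq, show i - lo + (j - i) = j - lo by omega]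
    simp
  · simp only [h17]
    omega

/-- The runs of length `w` into which the `N` cells of `f` from `base` on are divided (the last run
may be shorter or empty) are sorted. -/
def RunsSorted (key : ℕ → ℝ) (f : ℕ → ℕ) (base w N : ℕ) : Prop :=
  ∀ q, (seg f (base + q * w) (min w (N - q * w))).Pairwise fun x y => keyLe key x y = true

/-- Runs `2 * q` and `2 * q + 1` of length `w`, with the ends cut off at `N`, merge into a sorted
list, which has the length of run `q` of length `2 * w`. -/
theorem RunsSorted.merge {key : ℕ → ℝ} {f : ℕ → ℕ} {base w N : ℕ} (h : RunsSorted key f base w N)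
    (q : ℕ) : (List.merge (seg f (base + q * (2 * w)) (min w (N - q * (2 * w))))
      (seg f (base + min (q * (2 * w) + w) N) (min (2 * w) (N - q * (2 * w)) -
        min w (N - q * (2 * w)))) (keyLe key)).Pairwise fun x y => keyLe key x y = true := by
  apply List.pairwise_merge
  · intro x y z h1 h2
    simp only [keyLe, decide_eq_true_eq] at h1 h2 ⊢
    exact h2.trans h1
  · intro x y
    simp only [keyLe, Bool.or_eq_true, decide_eq_true_eq]
    exact le_total _ _
  · have := h (2 * q)
    rwa [show 2 * q * w = q * (2 * w) by ring] at this
  · have := h (2 * q + 1)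
    rw [show (2 * q + 1) * w = q * (2 * w) + w by ring] at this
    rcases le_total (q * (2 * w) + w) N with h' | h'
    · rwa [min_eq_left h', show min (2 * w) (N - q * (2 * w)) - min w (N - q * (2 * w)) =
        min w (N - (q * (2 * w) + w)) by omega]
    · rw [show min (2 * w) (N - q * (2 * w)) - min w (N - q * (2 * w)) = 0 by omega]
      simp

/-- The minimum of two natural numbers. -/
def minExp (e f : NExp) : NExp := .minus e (.minus e f)

theorem minExp_eval (e f : NExp) (σ : Store) : (minExp e f).eval σ = min (e.eval σ) (f.eval σ) := by
  simp only [minExp, NExp.eval]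
  omega

/-- One pass of bottom-up merge sort: the runs of length register `11` in the cells from register
`10` on are merged in pairs. -/
def mergePass (v a : ℕ) : Prog :=
  .setReg 12 (.const 0) ;; .setReg 17 (.plus (.reg 10) (.reg 2)) ;;
  .loop (.natLt (.reg 12) (.reg 2))
    (.setReg 13 (.plus (.reg 10) (.reg 12)) ;;
    .setReg 14 (.plus (.reg 10) (minExp (.plus (.reg 12) (.reg 11)) (.reg 2))) ;;
    .setReg 15 (.reg 14) ;;
    .setReg 16 (.plus (.reg 10)
      (minExp (.plus (.reg 12) (.plus (.reg 11) (.reg 11))) (.reg 2))) ;;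
    mergeRuns v a ;;
    .setReg 12 (.plus (.reg 12) (.plus (.reg 11) (.reg 11))))

theorem mergePass_spec {v a base w N : ℕ} {σ : Store} (hw : 0 < w) (h2 : σ.reg 2 = N)
    (h10 : σ.reg 10 = base) (h11 : σ.reg 11 = w)
    (hs : RunsSorted (σ.val v) (σ.idx a) base w N) :
    Reaches (mergePass v a) σ (120 * N + 40) fun σ' =>
      Keeps a 12 σ σ' ∧ RunsSorted (σ.val v) (σ'.idx a) (base + N) (2 * w) N ∧
      (seg (σ'.idx a) (base + N) N).Perm (seg (σ.idx a) base N) := by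
  set f := σ.idx a with hf
  refine (Reaches.seq (.setReg (.seq (.setReg (Reaches.mono (Reaches.loop
    (fun τ => Keeps a 12 σ τ ∧ (∀ p, p < base + N → τ.idx a p = f p) ∧
      ∃ q, τ.reg 12 = q * (2 * w) ∧ τ.reg 17 = base + N + min (q * (2 * w)) N ∧
        (∀ q', q' < q → (seg (τ.idx a) (base + N + q' * (2 * w))
          (min (2 * w) (N - q' * (2 * w)))).Pairwise fun x y => keyLe (σ.val v) x y = true) ∧
        (seg (τ.idx a) (base + N) (min (q * (2 * w)) N)).Perm
          (seg f base (min (q * (2 * w)) N)))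
    (fun τ => 120 * (N - τ.reg 12) + 10) ?_ ?_ ?_)
    (T' := 120 * N + 10) ?_ fun _ h => h))))).mono
    (by simp only [NExp.cost]; omega) fun _ h => h
  · refine ⟨((Keeps.refl _ _ _).setReg (by omega) _).setReg (by omega) _, fun _ _ => rfl, 0,
      by simp [NExp.eval], by simp [NExp.eval, h2, h10], fun q' h => absurd h (by omega), ?_⟩
    simp
  · rintro τ ⟨hk, hlow, q, h12, h17, hsort, hperm⟩ hb
    have hτ2 : τ.reg 2 = N := (hk.reg 2 (by omega)).trans h2
    have hτ10 : τ.reg 10 = base := (hk.reg 10 (by omega)).trans h10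
    have hτ11 : τ.reg 11 = w := (hk.reg 11 (by omega)).trans h11
    simp only [Test.Holds, NExp.eval, h12, hτ2] at hb
    have hm := hs.merge q
    have hq1 : (q + 1) * (2 * w) = q * (2 * w) + 2 * w := by ring
    have hqq : ∀ q', q' < q → q' * (2 * w) + 2 * w ≤ q * (2 * w) := by
      intro q' h
      calc q' * (2 * w) + 2 * w = (q' + 1) * (2 * w) := by ring
        _ ≤ q * (2 * w) := Nat.mul_le_mul_right _ h
    rw [min_eq_left hb.le] at h17 hperm
    generalize q * (2 * w) = L at hb hm h12 h17 hperm hq1 hqq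
    refine ⟨_, .seq (.setReg (.seq (.setReg (.seq (.setReg (.seq (.setReg (.seq
      ((mergeRuns_spec (lo := base + L) (mid := base + min (L + w) N)
        (hi := base + min (L + 2 * w) N) (N := N) (by omega) (by omega) (by omega)
        (by simp [hτ2]) (by simp [NExp.eval, hτ10, h12])
        (by simp [minExp_eval, NExp.eval, hτ10, hτ2, h12, hτ11])
        (by simp [minExp_eval, NExp.eval, hτ10, hτ2, h12, hτ11])
        (by simp [minExp_eval, NExp.eval, hτ10, hτ2, h12, hτ11]; omega)
        (by simp [h17]; omega)).mono le_rfl fun ρ hρ => .setReg ?_)))))))))⟩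
    obtain ⟨hk', h17', hlow', hseg⟩ := hρ
    simp only [Store.setReg_idx, Store.setReg_val] at hlow' hseg
    have hk'' : Keeps a 12 τ ρ := by
      refine Keeps.trans ?_ (hk'.mono (by omega))
      exact ((((Keeps.refl _ _ _).setReg (by omega) _).setReg (by omega) _).setReg
        (by omega) _).setReg (by omega) _
    have hρ12 : ρ.reg 12 = L := by
      rw [hk'.reg 12 (by omega)]
      simp [h12]
    have hρ11 : ρ.reg 11 = w := (hk''.reg 11 (by omega)).trans hτ11
    have hv : τ.val = σ.val := hk.val
    rw [show base + min (L + 2 * w) N - (base + L) = min (2 * w) (N - L) by omega,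
      show base + min (L + w) N - (base + L) = min w (N - L) by omega,
      show base + min (L + 2 * w) N - (base + min (L + w) N) =
        min (2 * w) (N - L) - min w (N - L) by omega, hv,
      seg_congr (g := f) fun p _ hp => hlow p (by omega),
      seg_congr (lo := base + min (L + w) N) (g := f) fun p _ hp => hlow p (by omega)] at hseg
    have hlen : min (L + 2 * w) N = L + min (2 * w) (N - L) := by omega
    refine ⟨⟨(hk.trans hk'').setReg (by omega) _, ?_, q + 1, ?_, ?_, ?_, ?_⟩, ?_⟩
    · intro p hp
      rw [Store.setReg_idx, hlow' p (by omega), hlow p hp]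
    · simp [NExp.eval, hρ12, hρ11, hq1]
      omega
    · simp [h17', hq1]
      omega
    · intro q' hq'
      rw [Store.setReg_idx]
      rcases Nat.lt_succ_iff_lt_or_eq.1 hq' with h | rfl
      · have h3 := hqq q' h
        rw [seg_congr (g := τ.idx a) fun p _ hp => hlow' p (by omega)]
        exact hsort q' h
      · have hL : q' * (2 * w) = L := by
          have : (q' + 1) * (2 * w) = q' * (2 * w) + 2 * w := by ring
          omega
        rw [hL, show base + N + L = base + L + N by omega, hseg]
        exact hm
    · rw [Store.setReg_idx, hq1, hlen, seg_add, seg_add,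
        seg_congr (g := τ.idx a) (lo := base + N) fun p _ hp => hlow' p (by omega),
        show base + N + L = base + L + N by omega, hseg]
      refine hperm.append ((List.merge_perm_append _).trans ?_)
      rcases le_total (L + w) N with h | h
      · rw [min_eq_left h, show min w (N - L) = w by omega,
          show base + (L + w) = base + L + w by omega, ← seg_add,
          show w + (min (2 * w) (N - L) - w) = min (2 * w) (N - L) by omega]
      · rw [show min (2 * w) (N - L) = min w (N - L) by omega, Nat.sub_self]
        simp
    · simp [NExp.eval, NExp.cost, Test.cost, minExp, hρ12, hρ11, h12]
      omega
  · rintro τ ⟨hk, hlow, q, h12, h17, hsort, hperm⟩ hb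
    have hτ2 : τ.reg 2 = N := (hk.reg 2 (by omega)).trans h2
    simp only [Test.Holds, NExp.eval, h12, hτ2, not_lt] at hb
    rw [min_eq_right hb] at hperm
    refine ⟨by simp [NExp.cost, Test.cost], hk, fun q' => ?_, hperm⟩
    rcases lt_or_ge q' q with h | h
    · exact hsort q' h
    · have : q * (2 * w) ≤ q' * (2 * w) := Nat.mul_le_mul_right _ h
      rw [show N - q' * (2 * w) = 0 by omega]
      simp
  · simp [NExp.eval]

/-- Fill the array `a` with the numbers below register `2`. -/
def initIdx (a : ℕ) : Prog :=
  .setReg 12 (.const 0) ;;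
  .loop (.natLt (.reg 12) (.reg 2))
    (.setIdx a (.reg 12) (.reg 12) ;; .setReg 12 (.plus (.reg 12) (.const 1)))

theorem initIdx_spec {a N : ℕ} {σ : Store} (h2 : σ.reg 2 = N) :
    Reaches (initIdx a) σ (20 * N + 20) fun σ' =>
      Keeps a 12 σ σ' ∧ ∀ p, p < N → σ'.idx a p = p := by
  refine (Reaches.seq (.setReg (Reaches.mono (Reaches.loop
    (fun τ => Keeps a 12 σ τ ∧ ∀ p, p < τ.reg 12 → τ.idx a p = p)
    (fun τ => 20 * (N - τ.reg 12) + 10) ?_ ?_ ?_)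
    (T' := 20 * N + 10) ?_ fun _ h => h))).mono
    (by simp only [NExp.cost]; omega) fun _ h => h
  · exact ⟨(Keeps.refl _ _ _).setReg (by omega) _, by simp [NExp.eval]⟩
  · rintro τ ⟨hk, hτ⟩ hb
    have hτ2 : τ.reg 2 = N := (hk.reg 2 (by omega)).trans h2
    simp only [Test.Holds, NExp.eval, hτ2] at hb
    refine ⟨_, .seq (.setIdx (.setReg ⟨⟨(hk.setIdx _ _).setReg (by omega) _, ?_⟩, ?_⟩))⟩
    · intro p hp
      simp only [NExp.eval, Store.setReg_reg, Store.setIdx_reg, if_true, Store.setReg_idx,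
        Store.setIdx_idx, true_and] at hp ⊢
      split_ifs with h
      · exact h.symm
      · exact hτ p (by omega)
    · simp [NExp.eval, NExp.cost, Test.cost]
      omega
  · rintro τ ⟨hk, hτ⟩ hb
    have hτ2 : τ.reg 2 = N := (hk.reg 2 (by omega)).trans h2
    simp only [Test.Holds, NExp.eval, hτ2] at hb
    exact ⟨by simp [NExp.cost, Test.cost], hk, fun p hp => hτ p (by omega)⟩
  · simp [NExp.eval]

/-- Bottom-up merge sort of the indices below register `2` by non-increasing key, where the keys are
the cells of the real array `v`. The sorted list starts at cell register `10` of the array `a`. -/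
def mergeSort (v a : ℕ) : Prog :=
  .setReg 10 (.const 0) ;; initIdx a ;; .setReg 11 (.const 1) ;;
  .loop (.natLt (.reg 11) (.reg 2))
    (mergePass v a ;; .setReg 10 (.plus (.reg 10) (.reg 2)) ;;
      .setReg 11 (.plus (.reg 11) (.reg 11)))

/-- After `p` passes, the runs have length `2 ^ p`; the potential counts the passes that are left. -/
theorem mergeSort_spec {v a N : ℕ} {σ : Store} (h2 : σ.reg 2 = N) :
    Reaches (mergeSort v a) σ (200 * (N * Nat.clog 2 N + N + 1)) fun σ' =>
      Keeps a 10 σ σ' ∧ (seg (σ'.idx a) (σ'.reg 10) N).Perm (List.range N) ∧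
      (seg (σ'.idx a) (σ'.reg 10) N).Pairwise fun x y => σ.val v y ≤ σ.val v x := by
  refine (Reaches.seq (.setReg (.seq ((initIdx_spec (N := N) (by simp [h2])).mono le_rfl
    (fun ρ hρ => .seq (.setReg (Reaches.mono (Reaches.loop
    (fun τ => Keeps a 10 σ τ ∧ ∃ p, τ.reg 11 = 2 ^ p ∧
      RunsSorted (σ.val v) (τ.idx a) (τ.reg 10) (2 ^ p) N ∧
      (seg (τ.idx a) (τ.reg 10) N).Perm (List.range N))
    (fun τ => (Nat.clog 2 N - Nat.clog 2 (τ.reg 11)) * (120 * N + 60) + 10) ?_ ?_ ?_)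
    (T' := Nat.clog 2 N * (120 * N + 60) + 10) ?_ fun _ h => h))))))).mono ?_ fun _ h => h
  · obtain ⟨hk, hρ⟩ := hρ
    have hk' : Keeps a 10 σ ρ := Keeps.trans ((Keeps.refl _ _ _).setReg (by omega) _)
      (hk.mono (by omega))
    have h10 : ρ.reg 10 = 0 := (hk.reg 10 (by omega)).trans (by simp [NExp.eval])
    refine ⟨hk'.setReg (by omega) _, 0, by simp [NExp.eval], fun q => ?_, ?_⟩
    · have : min (2 ^ 0) (N - q * 2 ^ 0) = 0 ∨ min (2 ^ 0) (N - q * 2 ^ 0) = 1 := by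
        simp only [pow_zero]
        omega
      rcases this with h | h <;> rw [h] <;> simp [seg]
    · simp only [Store.setReg_idx, Store.setReg_reg, h10]
      rw [if_neg (by omega), seg_congr (g := id) fun p _ hp => hρ p (by omega), seg,
        List.map_id, List.range_eq_range']
  · rintro τ ⟨hk, p, h11, hsort, hperm⟩ hb
    have hτ2 : τ.reg 2 = N := (hk.reg 2 (by omega)).trans h2
    simp only [Test.Holds, NExp.eval, h11, hτ2] at hb
    have hv : τ.val = σ.val := hk.val
    rw [← hv] at hsort
    refine ⟨_, .seq ((mergePass_spec (by positivity) hτ2 rfl h11 hsort).mono le_rfl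
      fun ρ hρ => .seq (.setReg (.setReg ?_)))⟩
    obtain ⟨hk', hsort', hperm'⟩ := hρ
    have h10 : ρ.reg 10 = τ.reg 10 := hk'.reg 10 (by omega)
    have hρ11 : ρ.reg 11 = 2 ^ p := (hk'.reg 11 (by omega)).trans h11
    have hρ2 : ρ.reg 2 = N := (hk'.reg 2 (by omega)).trans hτ2
    refine ⟨⟨((hk.trans (hk'.mono (by omega))).setReg (by omega) _).setReg
      (by omega) _, p + 1, ?_, ?_, ?_⟩, ?_⟩
    · simp [NExp.eval, hρ11]
      ring
    · rw [hv] at hsort'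
      simpa [NExp.eval, h10, hρ2, pow_succ'] using hsort'
    · simpa [NExp.eval, h10, hρ2] using hperm'.trans hperm
    · have h3 : p < Nat.clog 2 N := (Nat.lt_clog_iff_pow_lt (by omega)).2 hb
      have h4 : Nat.clog 2 N - p = Nat.clog 2 N - (p + 1) + 1 := by omega
      have h5 : Nat.clog 2 (2 ^ p + 2 ^ p) = p + 1 := by
        rw [← two_mul, ← pow_succ', Nat.clog_pow _ _ (by omega)]
      simp only [Test.cost, NExp.cost, NExp.eval, Store.setReg_reg, h11, hρ11, if_true,
        Nat.clog_pow 2 p (by omega)]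
      simp [h5]
      rw [h4, add_mul]
      omega
  · rintro τ ⟨hk, p, h11, hsort, hperm⟩ hb
    have hτ2 : τ.reg 2 = N := (hk.reg 2 (by omega)).trans h2
    simp only [Test.Holds, NExp.eval, h11, hτ2, not_lt] at hb
    refine ⟨by simp [NExp.cost, Test.cost], hk, hperm, ?_⟩
    have := hsort 0
    rw [zero_mul, add_zero, Nat.sub_zero, min_eq_right hb] at this
    simpa [keyLe] using this
  · simp [NExp.eval]
  · rcases Nat.eq_zero_or_pos N with rfl | hN
    · simp [NExp.cost]
    · have : Nat.clog 2 N ≤ N * Nat.clog 2 N := Nat.le_mul_of_pos_left _ hN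
      simp only [NExp.cost]
      nlinarith

section Program

/-! ### The program for Next Fit Decreasing -/

/-- Sorting: afterwards, the sorted items start at cell register `3` of array `1`, and the sorted
bins start at cell register `4` of array `2`. -/
def sortAll : Prog :=
  .setReg 2 (.reg 0) ;; mergeSort 0 1 ;; .setReg 3 (.reg 10) ;;
  .setReg 2 (.reg 1) ;; mergeSort 1 2 ;; .setReg 4 (.reg 10)

/-- Cell `0` of the real array `2` becomes the total size of the items. -/
def sumSizes : Prog :=
  .setReg 5 (.const 0) ;;
  .loop (.natLt (.reg 5) (.reg 0))
    (.setVal 2 (.const 0) (.plus (.read 2 (.const 0)) (.read 0 (.reg 5))) ;;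
      .setReg 5 (.plus (.reg 5) (.const 1)))

/-- Unassigned items, from position register `6` on, are put into the bin in register `7` until it
is covered; cell `j` of array `0` then holds the number of the bin of item `j`, plus one. Cell `1` of
the real array `2` is the total size of the items in the bin. -/
def fillBin : Prog :=
  .loop (.realLt (.read 2 (.const 1)) (.read 1 (.reg 7)))
    (.setReg 8 (.read 1 (.plus (.reg 3) (.reg 6))) ;;
      .setVal 2 (.const 1) (.plus (.read 2 (.const 1)) (.read 0 (.reg 8))) ;;
      .setIdx 0 (.reg 8) (.plus (.reg 7) (.const 1)) ;;
      .setReg 6 (.plus (.reg 6) (.const 1)))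

/-- The main loop. Register `5` is the position of the current bin, and cell `0` of the real array
`2` is the total size of the unassigned items. -/
def mainLoop : Prog :=
  .setReg 5 (.const 0) ;; .setReg 6 (.const 0) ;;
  .loop (.natLt (.reg 5) (.reg 1))
    (.setReg 7 (.read 2 (.plus (.reg 4) (.reg 5))) ;;
      .branch (.realLt (.read 2 (.const 0)) (.read 1 (.reg 7))) .skip
        (.setVal 2 (.const 1) .zero ;; fillBin ;;
          .setVal 2 (.const 0) (.minus (.read 2 (.const 0)) (.read 2 (.const 1)))) ;;
      .setReg 5 (.plus (.reg 5) (.const 1)))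

/-- Next Fit Decreasing. -/
def nfdProg : Prog := sortAll ;; sumSizes ;; mainLoop

theorem exists_perm_of_sorted {n base : ℕ} {f : ℕ → ℕ} {key : ℕ → ℝ}
    (hperm : (seg f base n).Perm (List.range n))
    (hsort : (seg f base n).Pairwise fun x y => key y ≤ key x) :
    ∃ τ : Equiv.Perm (Fin n), (∀ p : Fin n, f (base + p) = τ p) ∧
      Antitone fun p => key (τ p) := by
  have hget : ∀ (p : ℕ) (h : p < (seg f base n).length), (seg f base n)[p] = f (base + p) := by
    intro p h
    simp [seg]
  have hlt : ∀ p : Fin n, f (base + p) < n := fun p => by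
    have h1 := List.getElem_mem (l := seg f base n) (n := p) (by simp)
    rw [hget, hperm.mem_iff, List.mem_range] at h1
    exact h1
  have hinj : Function.Injective fun p : Fin n => (⟨f (base + p), hlt p⟩ : Fin n) := by
    intro p q hpq
    have hnd : (seg f base n).Nodup := hperm.nodup_iff.2 List.nodup_range
    rw [Fin.mk.injEq, ← hget p (by simp), ← hget q (by simp), hnd.getElem_inj_iff] at hpq
    exact Fin.ext hpq
  refine ⟨Equiv.ofBijective _ (Finite.injective_iff_bijective.1 hinj), fun p => rfl, ?_⟩
  intro p q hpq
  rcases hpq.eq_or_lt with rfl | hpq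
  · exact le_rfl
  · have h2 := List.pairwise_iff_getElem.1 hsort p q (by simp) (by simp) hpq
    rwa [hget, hget] at h2

variable {m n : ℕ}

/-- The instance and the sorting permutations are in memory. -/
structure Sorted (d : Fin m → ℝ) (s : Fin n → ℝ) (β : Equiv.Perm (Fin m)) (τ : Equiv.Perm (Fin n))
    (σ : Store) : Prop where
  items : σ.reg 0 = n
  bins : σ.reg 1 = m
  size : ∀ j : Fin n, σ.val 0 j = s j
  demand : ∀ i : Fin m, σ.val 1 i = d i
  item : ∀ p : Fin n, σ.idx 1 (σ.reg 3 + p) = τ p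
  bin : ∀ p : Fin m, σ.idx 2 (σ.reg 4 + p) = β p

section Sorted

variable {d : Fin m → ℝ} {s : Fin n → ℝ} {β : Equiv.Perm (Fin m)} {τ : Equiv.Perm (Fin n)}
  {σ : Store}

theorem Sorted.setReg (h : Sorted d s β τ σ) {x : ℕ} (hx : 5 ≤ x) (v : ℕ) :
    Sorted d s β τ (σ.setReg x v) := by
  have hne : ∀ y, y < 5 → (σ.setReg x v).reg y = σ.reg y := fun y hy => by
    rw [Store.setReg_reg, if_neg (by omega)]
  exact ⟨by rw [hne 0 (by omega), h.items], by rw [hne 1 (by omega), h.bins], h.size, h.demand,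
    fun p => by rw [hne 3 (by omega), Store.setReg_idx, h.item],
    fun p => by rw [hne 4 (by omega), Store.setReg_idx, h.bin]⟩

theorem Sorted.setIdx (h : Sorted d s β τ σ) (k v : ℕ) : Sorted d s β τ (σ.setIdx 0 k v) :=
  ⟨h.items, h.bins, h.size, h.demand,
    fun p => by simp [h.item], fun p => by simp [h.bin]⟩

theorem Sorted.setVal (h : Sorted d s β τ σ) (k : ℕ) (r : ℝ) : Sorted d s β τ (σ.setVal 2 k r) :=
  ⟨h.items, h.bins, fun j => by simp [h.size], fun i => by simp [h.demand], h.item, h.bin⟩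

theorem sortAll_spec (d : Fin m → ℝ) (s : Fin n → ℝ) :
    Reaches sortAll (inputStore d s)
      (200 * (n * Nat.clog 2 n + n + 1) + 200 * (m * Nat.clog 2 m + m + 1) + 20) fun σ =>
      (∀ p, σ.idx 0 p = 0) ∧ (∀ p, σ.val 2 p = 0) ∧ ∃ β τ, Sorted d s β τ σ ∧
        Antitone (d ∘ β) ∧ Antitone (s ∘ τ) := by
  refine (Reaches.seq (.setReg (.seq ((mergeSort_spec (N := n) ?_).mono le_rfl fun σ₁ h₁ =>
    .seq (.setReg (.seq (.setReg (.seq ((mergeSort_spec (N := m) ?_).mono le_rfl fun σ₂ h₂ =>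
    .setReg ?_))))))))).mono ?_ fun _ h => h
  · simp [NExp.eval, inputStore]
  · have := h₁.1.reg 1 (by omega)
    simp [NExp.eval, this]
    simp [inputStore]
  · obtain ⟨hk₁, hp₁, hs₁⟩ := h₁
    obtain ⟨hk₂, hp₂, hs₂⟩ := h₂
    have hv₁ : σ₁.val = (inputStore d s).val := hk₁.val
    have hv₂ : σ₂.val = (inputStore d s).val := hk₂.val.trans hv₁
    have hsize : ∀ j : Fin n, (inputStore d s).val 0 j = s j := fun j => by simp [inputStore]
    have hdemand : ∀ i : Fin m, (inputStore d s).val 1 i = d i := fun i => by simp [inputStore]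
    obtain ⟨τ, hτ, hτs⟩ := exists_perm_of_sorted hp₁ hs₁
    obtain ⟨β, hβ, hβs⟩ := exists_perm_of_sorted hp₂ hs₂
    have hr : ∀ x, x < 2 → σ₂.reg x = (inputStore d s).reg x := fun x hx => by
      rw [hk₂.reg x (by omega), Store.setReg_reg, if_neg (by omega), Store.setReg_reg,
        if_neg (by omega), hk₁.reg x (by omega), Store.setReg_reg, if_neg (by omega)]
    have hi1 : σ₂.idx 1 = σ₁.idx 1 := hk₂.idx 1 (by omega)
    have hr3 : σ₂.reg 3 = σ₁.reg 10 := by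
      rw [hk₂.reg 3 (by omega)]
      simp [NExp.eval]
    refine ⟨fun p => ?_, fun p => ?_, β, τ, ⟨?_, ?_, ?_, ?_, ?_, ?_⟩, ?_, ?_⟩
    · rw [Store.setReg_idx, hk₂.idx 0 (by omega), Store.setReg_idx, Store.setReg_idx,
        hk₁.idx 0 (by omega)]
      rfl
    · rw [Store.setReg_val, hv₂]
      simp [inputStore]
    · simp [hr 0 (by omega)]
      simp [inputStore]
    · simp [hr 1 (by omega)]
      simp [inputStore]
    · intro j
      rw [Store.setReg_val, hv₂, hsize]
    · intro i
      rw [Store.setReg_val, hv₂, hdemand]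
    · intro p
      simp only [Store.setReg_idx, Store.setReg_reg, hi1]
      rw [if_neg (by omega), hr3, hτ]
    · intro p
      simp [NExp.eval, hβ]
    · intro p q hpq
      have := hβs hpq
      simp only [Store.setReg_val, hv₁, hdemand] at this
      exact this
    · intro p q hpq
      have := hτs hpq
      simp only [Store.setReg_val, hsize] at this
      exact this
  · simp only [NExp.cost]
    omega

theorem sum_block_comp_perm (s : Fin n → ℝ) (τ : Equiv.Perm (Fin n)) :
    ∑ l ∈ block n 0 n, (s ∘ τ) l = ∑ l ∈ block n 0 n, s l := by
  have h : block n 0 n = univ := by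
    ext l
    simp [mem_block]
  rw [h]
  exact Equiv.sum_comp τ s

theorem sumSizes_spec (h : Sorted d s β τ σ) (hv : ∀ p, σ.val 2 p = 0) :
    Reaches sumSizes σ (30 * n + 30) fun σ' => Sorted d s β τ σ' ∧ σ'.idx = σ.idx ∧
      σ'.val 2 0 = ∑ l ∈ block n 0 n, s l := by
  refine (Reaches.seq (.setReg (Reaches.mono (Reaches.loop
    (fun ρ => Sorted d s β τ ρ ∧ ρ.idx = σ.idx ∧ ρ.reg 5 ≤ n ∧
      ρ.val 2 0 = ∑ l ∈ block n 0 (ρ.reg 5), s l)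
    (fun ρ => 30 * (n - ρ.reg 5) + 10) ?_ ?_ ?_)
    (T' := 30 * n + 10) ?_ fun _ h => h))).mono (by simp only [NExp.cost]; omega) fun _ h => h
  · refine ⟨h.setReg (by omega) _, rfl, by simp [NExp.eval], ?_⟩
    simp [NExp.eval, sum_block_self, hv]
  · rintro ρ ⟨hρ, hidx, hle, hval⟩ hb
    simp only [Test.Holds, NExp.eval, hρ.items] at hb
    refine ⟨_, .seq (.setVal (.setReg ⟨⟨(hρ.setVal _ _).setReg (by omega) _, hidx, ?_, ?_⟩, ?_⟩))⟩
    · simp only [NExp.eval, Store.setReg_reg, Store.setVal_reg, if_true]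
      omega
    · have h1 := hρ.size ⟨ρ.reg 5, hb⟩
      simp only at h1
      simp [NExp.eval, RExp.eval, hval, sum_block_succ s (Nat.zero_le _) hb, h1]
    · simp [NExp.eval, NExp.cost, RExp.cost, Test.cost]
      omega
  · rintro ρ ⟨hρ, hidx, hle, hval⟩ hb
    simp only [Test.Holds, NExp.eval, hρ.items, not_lt] at hb
    refine ⟨by simp [NExp.cost, Test.cost], hρ, hidx, ?_⟩
    rw [hval, le_antisymm hle hb]
  · simp [NExp.eval]

theorem fillBin_spec (h : Sorted d s β τ σ) (hd : ∀ i, 0 < d i) {i : Fin m}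
    (hf : Fills (d ∘ β) (s ∘ τ) i) (h6 : σ.reg 6 = nfdStart (d ∘ β) (s ∘ τ) i)
    (h7 : σ.reg 7 = β i) (hv : σ.val 2 1 = 0) :
    Reaches fillBin σ
      (60 * (nfdStart (d ∘ β) (s ∘ τ) (i + 1) - nfdStart (d ∘ β) (s ∘ τ) i) + 10) fun σ' =>
      Sorted d s β τ σ' ∧ σ'.reg 5 = σ.reg 5 ∧ σ'.reg 6 = nfdStart (d ∘ β) (s ∘ τ) (i + 1) ∧
      σ'.val 2 0 = σ.val 2 0 ∧ σ'.val 2 1 = ∑ l ∈ block n (nfdStart (d ∘ β) (s ∘ τ) i)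
        (nfdStart (d ∘ β) (s ∘ τ) (i + 1)), (s ∘ τ) l ∧
      ∀ p : Fin n, σ'.idx 0 (τ p) = if nfdStart (d ∘ β) (s ∘ τ) i ≤ p ∧
        (p : ℕ) < nfdStart (d ∘ β) (s ∘ τ) (i + 1) then (β i : ℕ) + 1 else σ.idx 0 (τ p) := by
  have hlt := hf.lt_succ
  have hle := hf.succ_le
  have hcov := hf.covered
  have hmin := fun b => hf.lt_of_lt (b := b) (show 0 < (d ∘ β) i from hd _)
  generalize nfdStart (d ∘ β) (s ∘ τ) i = j₀ at *
  generalize nfdStart (d ∘ β) (s ∘ τ) (i + 1) = j₁ at *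
  refine (Reaches.loop
    (fun ρ => Sorted d s β τ ρ ∧ ρ.reg 5 = σ.reg 5 ∧ ρ.reg 7 = β i ∧ j₀ ≤ ρ.reg 6 ∧ ρ.reg 6 ≤ j₁ ∧
      ρ.val 2 0 = σ.val 2 0 ∧ ρ.val 2 1 = ∑ l ∈ block n j₀ (ρ.reg 6), (s ∘ τ) l ∧
      ∀ p : Fin n, ρ.idx 0 (τ p) = if j₀ ≤ p ∧ (p : ℕ) < ρ.reg 6 then (β i : ℕ) + 1 else σ.idx 0 (τ p))
    (fun ρ => 60 * (j₁ - ρ.reg 6) + 10) ?_ ?_ ?_).mono ?_ fun _ h => h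
  · refine ⟨h, rfl, h7, h6.ge, by omega, rfl, ?_, fun p => ?_⟩
    · rw [h6, sum_block_self, hv]
    · rw [if_neg (by omega)]
  · rintro ρ ⟨hρ, h5, h7, hj₀, hj₁, hv0, hv1, hout⟩ hb
    simp only [Test.Holds, RExp.eval, NExp.eval, h7, hρ.demand] at hb
    have hj : ρ.reg 6 < j₁ := by
      refine lt_of_le_of_ne hj₁ fun heq => ?_
      rw [hv1, heq] at hb
      exact hb.not_ge hcov
    have hjn : ρ.reg 6 < n := by omega
    have hitem := hρ.item ⟨ρ.reg 6, hjn⟩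
    simp only at hitem
    refine ⟨_, .seq (.setReg (.seq (.setVal (.seq (.setIdx (.setReg ⟨⟨(((hρ.setReg (by omega)
      _).setVal _ _).setIdx _ _).setReg (by omega) _, ?_, ?_, ?_, ?_, ?_, ?_, ?_⟩, ?_⟩))))))⟩
    · simp [h5]
    · simp [h7]
    · simp [NExp.eval]
      omega
    · simp [NExp.eval]
      omega
    · simp [NExp.eval, hv0]
    · have hsum := sum_block_succ (s ∘ τ) hj₀ hjn
      simp only [Function.comp_apply] at hsum
      simp [NExp.eval, RExp.eval, hv1, hitem, hρ.size, hsum]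
    · intro p
      have hiff : τ p = τ ⟨ρ.reg 6, hjn⟩ ↔ (p : ℕ) = ρ.reg 6 := by
        rw [τ.injective.eq_iff, Fin.ext_iff]
      simp [NExp.eval, hitem, h7, hout]
      split_ifs <;> first | rfl | omega
    · simp [NExp.eval, NExp.cost, RExp.cost, Test.cost]
      omega
  · rintro ρ ⟨hρ, h5, h7, hj₀, hj₁, hv0, hv1, hout⟩ hb
    simp only [Test.Holds, RExp.eval, NExp.eval, h7, hρ.demand, not_lt] at hb
    have hj : ρ.reg 6 = j₁ := by
      refine le_antisymm hj₁ (not_lt.1 fun hlt => ?_)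
      have := hmin _ hj₀ hlt
      rw [hv1] at hb
      exact hb.not_gt this
    rw [hj] at hv1 hout
    exact ⟨by simp [NExp.cost, RExp.cost, Test.cost], hρ, h5, hj, hv0, hv1, hout⟩
  · simp [h6]

end Sorted

end Program

section MainLoop

variable {m n : ℕ} {d : Fin m → ℝ} {s : Fin n → ℝ} {β : Equiv.Perm (Fin m)}
  {τ : Equiv.Perm (Fin n)} {σ : Store}

/-- The main loop follows `nfdStart`. An iteration costs a constant amount for the bin and for each
item that is moved. -/
theorem mainLoop_spec (h : Sorted d s β τ σ) (hd : ∀ i, 0 < d i) (h0 : ∀ p, σ.idx 0 p = 0)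
    (hv : σ.val 2 0 = ∑ l ∈ block n 0 n, (s ∘ τ) l) :
    Reaches mainLoop σ (100 * m + 60 * n + 30) fun σ' =>
      (∀ b : Fin m, ∀ p : Fin n, nfdStart (d ∘ β) (s ∘ τ) b ≤ p →
        (p : ℕ) < nfdStart (d ∘ β) (s ∘ τ) (b + 1) → σ'.idx 0 (τ p) = β b + 1) ∧
      ∀ p : Fin n, nfdStart (d ∘ β) (s ∘ τ) m ≤ p → σ'.idx 0 (τ p) = 0 := by
  have hd' : ∀ i, 0 < (d ∘ β) i := fun i => hd _
  refine (Reaches.seq (.setReg (.seq (.setReg (Reaches.mono (Reaches.loop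
    (fun ρ => Sorted d s β τ ρ ∧ ρ.reg 5 ≤ m ∧ ρ.reg 6 = nfdStart (d ∘ β) (s ∘ τ) (ρ.reg 5) ∧
      ρ.val 2 0 = ∑ l ∈ block n (ρ.reg 6) n, (s ∘ τ) l ∧
      (∀ b : Fin m, (b : ℕ) < ρ.reg 5 → ∀ p : Fin n, nfdStart (d ∘ β) (s ∘ τ) b ≤ p →
        (p : ℕ) < nfdStart (d ∘ β) (s ∘ τ) (b + 1) → ρ.idx 0 (τ p) = β b + 1) ∧
      ∀ p : Fin n, ρ.reg 6 ≤ p → ρ.idx 0 (τ p) = 0)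
    (fun ρ => 100 * (m - ρ.reg 5) + 60 * (n - ρ.reg 6) + 10) ?_ ?_ ?_)
    (T' := 100 * m + 60 * n + 10) ?_ fun _ h => h))))).mono
      (by simp only [NExp.cost]; omega) fun _ h => h
  · refine ⟨(h.setReg (by omega) _).setReg (by omega) _, by simp [NExp.eval],
      by simp [NExp.eval, nfdStart], ?_, fun b hb => ?_, fun p _ => by simp [h0]⟩
    · simpa [NExp.eval] using hv
    · simp [NExp.eval] at hb
  · rintro ρ ⟨hρ, hle, h6, hval, hout, hfree⟩ hb
    simp only [Test.Holds, NExp.eval, hρ.bins] at hb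
    obtain ⟨i, hi⟩ : ∃ i : Fin m, (i : ℕ) = ρ.reg 5 := ⟨⟨_, hb⟩, rfl⟩
    rw [← hi] at h6 hout
    have hbin := hρ.bin i
    rw [hi] at hbin
    have h7 : (ρ.setReg 7 (NExp.eval ρ (.read 2 (.plus (.reg 4) (.reg 5))))).reg 7 = β i := by
      simp [NExp.eval, hbin]
    have htest : (Test.realLt (.read 2 (.const 0)) (.read 1 (.reg 7))).Holds
        (ρ.setReg 7 (NExp.eval ρ (.read 2 (.plus (.reg 4) (.reg 5))))) ↔
        ∑ l ∈ block n (nfdStart (d ∘ β) (s ∘ τ) i) n, (s ∘ τ) l < (d ∘ β) i := by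
      change ρ.val 2 0 < ρ.val 1 (Store.reg _ 7) ↔ _
      rw [h7, hρ.demand, hval, h6]
      rfl
    refine ⟨_, .seq (.setReg (.seq (.branch (fun hb' => .skip (.setReg ?_)) fun hb' => .seq (.setVal
      (.seq ((fillBin_spec ((hρ.setReg (by omega) _).setVal _ _) hd (i := i) ?_ ?_ ?_ ?_).mono
        le_rfl fun ρ' hρ' => .setVal (.setReg ?_)))))))⟩
    · -- the bin is skipped
      have hnf : ¬ Fills (d ∘ β) (s ∘ τ) i := by
        intro hf
        exact (htest.1 hb').not_ge hf.2
      have hst := nfdStart_succ_of_not_fills hnf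
      refine ⟨⟨(hρ.setReg (by omega) _).setReg (by omega) _, ?_, ?_, ?_, ?_, ?_⟩, ?_⟩
      · simp [NExp.eval]
        omega
      · simp [NExp.eval, h6, ← hi, hst]
      · simpa using hval
      · intro b hbi p hp hp'
        simp only [NExp.eval, Store.setReg_reg, if_true] at hbi
        simp only [Store.setReg_idx]
        rcases eq_or_ne b i with rfl | hne
        · omega
        · refine hout b ?_ p hp hp'
          have := Fin.val_ne_of_ne hne
          simp at hbi
          omega
      · intro p hp
        exact hfree p (by simpa using hp)
      · simp [NExp.eval, NExp.cost, RExp.cost, Test.cost]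
        omega
    · -- the bin gets covered
      by_contra hnf
      exact hb' (htest.2 (rest_lt_of_not_fills hd' hnf))
    · simp [h6]
    · exact h7
    · simp [RExp.eval, NExp.eval]
    · obtain ⟨hs', h5', h6', hv0', hv1', hout'⟩ := hρ'
      have hst := nfdStart_le_succ (d := d ∘ β) (s := s ∘ τ) i
      have hst' := nfdStart_le (d := d ∘ β) (s := s ∘ τ) (i + 1)
      have h5'' : ρ'.reg 5 = i := by
        rw [h5']
        simp [hi]
      have hidx : ∀ p, ((ρ.setReg 7 (NExp.eval ρ (.read 2 (.plus (.reg 4) (.reg 5))))).setVal 2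
          (NExp.eval (ρ.setReg 7 (NExp.eval ρ (.read 2 (.plus (.reg 4) (.reg 5))))) (.const 1))
          (RExp.eval (ρ.setReg 7 (NExp.eval ρ (.read 2 (.plus (.reg 4) (.reg 5))))) .zero)).idx 0 p
          = ρ.idx 0 p := fun p => rfl
      simp only [hidx] at hout'
      refine ⟨⟨(hs'.setVal _ _).setReg (by omega) _, ?_, ?_, ?_, ?_, ?_⟩, ?_⟩
      · simp [NExp.eval, h5'']
      · simp [NExp.eval, h5'', h6']
      · have h8 := sum_block_add (s ∘ τ) hst hst'
        simp only [Function.comp_apply] at h8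
        simp [NExp.eval, RExp.eval, h6', hv0', hv1', hval, h6, ← h8]
      · intro b hbi p hp hp'
        simp only [NExp.eval, Store.setReg_reg, Store.setVal_reg, if_true, h5''] at hbi
        simp only [Store.setReg_idx, Store.setVal_idx, hout']
        rcases eq_or_ne b i with rfl | hne
        · rw [if_pos ⟨hp, hp'⟩]
        · have h8 := Fin.val_ne_of_ne hne
          have h9 : (b : ℕ) + 1 ≤ i := by omega
          have h10 := nfdStart_mono (d := d ∘ β) (s := s ∘ τ) h9
          rw [if_neg (by omega)]
          exact hout b h9 p hp hp'
      · intro p hp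
        simp only [Store.setReg_reg, Store.setVal_reg, h6'] at hp
        simp only [Store.setReg_idx, Store.setVal_idx, hout']
        simp at hp
        rw [if_neg (by omega)]
        exact hfree p (by omega)
      · simp [NExp.eval, NExp.cost, RExp.cost, Test.cost, h5'', h6', h6, ← hi]
        omega
  · rintro ρ ⟨hρ, hle, h6, hval, hout, hfree⟩ hb
    simp only [Test.Holds, NExp.eval, hρ.bins, not_lt] at hb
    have h5 : ρ.reg 5 = m := le_antisymm hle hb
    rw [h5] at h6 hout
    rw [h6] at hfree
    exact ⟨by simp [NExp.cost, Test.cost], fun b => hout b b.2, hfree⟩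
  · simp [NExp.eval]

theorem exists_bin_of_lt (p : ℕ) (hp : p < nfdStart d s m) :
    ∃ b : Fin m, nfdStart d s b ≤ p ∧ p < nfdStart d s (b + 1) := by
  classical
  have hex : ∃ k, p < nfdStart d s k := ⟨m, hp⟩
  have hle := Nat.find_min' hex hp
  have hspec := Nat.find_spec hex
  obtain ⟨k, hk⟩ : ∃ k, Nat.find hex = k + 1 := by
    refine Nat.exists_eq_succ_of_ne_zero fun h => ?_
    rw [h] at hspec
    simp [nfdStart] at hspec
  rw [hk] at hspec hle
  exact ⟨⟨k, hle⟩, not_lt.1 (Nat.find_min hex (by omega : k < Nat.find hex)), hspec⟩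

theorem isNFD_outputSolution (hβ : Antitone (d ∘ β)) (hτ : Antitone (s ∘ τ))
    (hin : ∀ b : Fin m, ∀ p : Fin n, nfdStart (d ∘ β) (s ∘ τ) b ≤ p →
      (p : ℕ) < nfdStart (d ∘ β) (s ∘ τ) (b + 1) → σ.idx 0 (τ p) = β b + 1)
    (hfree : ∀ p : Fin n, nfdStart (d ∘ β) (s ∘ τ) m ≤ p → σ.idx 0 (τ p) = 0) :
    IsNFD d s (outputSolution m n σ) := by
  refine ⟨β, τ, hβ, hτ, fun i => ?_⟩
  ext j
  obtain ⟨p, rfl⟩ := τ.surjective j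
  simp only [outputSolution, mem_filter, mem_univ, true_and]
  rw [show τ p = τ.toEmbedding p from rfl, mem_map', nfdSorted, mem_block]
  refine ⟨fun h => ?_, fun h => hin i p h.1 h.2⟩
  rcases lt_or_ge (p : ℕ) (nfdStart (d ∘ β) (s ∘ τ) m) with hp | hp
  · obtain ⟨b, hb, hb'⟩ := exists_bin_of_lt _ hp
    have h1 := hin b p hb hb'
    rw [show τ.toEmbedding p = τ p from rfl, h1, Nat.add_right_cancel_iff, Fin.val_inj,
      β.injective.eq_iff] at h
    exact h ▸ ⟨hb, hb'⟩
  · have h1 := hfree p hp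
    rw [show τ.toEmbedding p = τ p from rfl, h1] at h
    omega

theorem nfdProg_spec (d : Fin m → ℝ) (s : Fin n → ℝ) (hd : ∀ i, 0 < d i) :
    Reaches nfdProg (inputStore d s)
      (500 * (n * Nat.clog 2 n + n) + 500 * (m * Nat.clog 2 m + m) + 500) fun σ =>
      IsNFD d s (outputSolution m n σ) := by
  refine (Reaches.seq ((sortAll_spec d s).mono le_rfl fun σ₁ h₁ => .seq (T := 30 * n + 30)
    (T' := 100 * m + 60 * n + 30) ?_)).mono (by omega) fun _ h => h
  obtain ⟨h0, hv, β, τ, hS, hβ, hτ⟩ := h₁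
  refine (sumSizes_spec hS hv).mono le_rfl fun σ₂ h₂ => ?_
  obtain ⟨hS₂, hidx, hval⟩ := h₂
  rw [← sum_block_comp_perm s τ] at hval
  exact (mainLoop_spec hS₂ hd (by simpa [hidx] using h0) hval).mono le_rfl
    fun σ₃ h₃ => isNFD_outputSolution hβ hτ h₃.1 h₃.2

theorem mul_clog_add_le (n : ℕ) :
    ((n * Nat.clog 2 n + n : ℕ) : ℝ) ≤ 6 * (n * Real.log n) + 1 := by
  rcases Nat.lt_or_ge n 2 with h | h
  · interval_cases n <;> simp
  · have h2 : (0 : ℝ) < n := by positivity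
    have hlog2 : (1 : ℝ) / 2 < Real.log 2 := by
      have := Real.log_two_gt_d9
      norm_num at this ⊢
      linarith
    have hlog : Real.log 2 ≤ Real.log n := Real.log_le_log (by norm_num) (by exact_mod_cast h)
    -- `2 ^ (clog 2 n - 1) < n`
    have h3 := Nat.pow_pred_clog_lt_self (b := 2) (by omega) (x := n) (by omega)
    have h4 : (Nat.clog 2 n - 1 : ℕ) * Real.log 2 ≤ Real.log n := by
      rw [← Real.log_pow]
      exact Real.log_le_log (by positivity) (by exact_mod_cast h3.le)
    have h5 : 0 < Nat.clog 2 n := Nat.clog_pos (by omega) h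
    rw [Nat.cast_sub h5, Nat.cast_one] at h4
    have h6 : (Nat.clog 2 n : ℝ) + 1 ≤ 6 * Real.log n := by nlinarith
    push_cast
    nlinarith

theorem exists_program : ∃ (P : Prog) (C : ℝ),
    ∀ (m n : ℕ) (d : Fin m → ℝ) (s : Fin n → ℝ), (∀ i, 0 < d i) → (∀ j, 0 ≤ s j) →
      ∃ (t : ℕ) (σ : Store), Runs P (inputStore d s) t σ ∧ IsNFD d s (outputSolution m n σ) ∧
        (t : ℝ) ≤ C * (n * Real.log n + m * Real.log m + 1) := by
  refine ⟨nfdProg, 3000, fun m n d s hd _ => ?_⟩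
  obtain ⟨t, σ, hr, ht, hN⟩ := nfdProg_spec d s hd
  refine ⟨t, σ, hr, hN, ?_⟩
  have h1 := mul_clog_add_le n
  have h2 := mul_clog_add_le m
  have h3 : (t : ℝ) ≤ 500 * ((n * Nat.clog 2 n + n : ℕ) : ℝ) +
      500 * ((m * Nat.clog 2 m + m : ℕ) : ℝ) + 500 := mod_cast ht
  linarith

end MainLoop

end BinCovering

theorem theorem2 :
    -- Next Fit Decreasing is a 9/4-approximation
    (∀ (m n : ℕ) (d : Fin m → ℝ) (s : Fin n → ℝ), (∀ i, 0 < d i) → (∀ j, 0 ≤ s j) →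
      (∃ S, BinCovering.IsNFD d s S) ∧
      ∀ S, BinCovering.IsNFD d s S →
        BinCovering.IsSolution S ∧
          BinCovering.opt d s ≤ 9 / 4 * BinCovering.profit d s S) ∧
    -- it can be carried out in time `O(n log n + m log m)`
    (∃ (P : BinCovering.Prog) (C : ℝ),
      ∀ (m n : ℕ) (d : Fin m → ℝ) (s : Fin n → ℝ), (∀ i, 0 < d i) → (∀ j, 0 ≤ s j) →
        ∃ (t : ℕ) (σ : BinCovering.Store),
          BinCovering.Runs P (BinCovering.inputStore d s) t σ ∧
          BinCovering.IsNFD d s (BinCovering.outputSolution m n σ) ∧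
          (t : ℝ) ≤ C * (n * Real.log n + m * Real.log m + 1)) ∧
    -- no ratio below 9/4 is possible
    (∀ ρ : ℝ, ρ < 9 / 4 →
      ∃ (m n : ℕ) (d : Fin m → ℝ) (s : Fin n → ℝ), (∀ i, 0 < d i) ∧ (∀ j, 0 < s j) ∧
        (∃ S, BinCovering.IsNFD d s S) ∧
        ∀ S, BinCovering.IsNFD d s S →
          0 < BinCovering.profit d s S ∧
            ρ * BinCovering.profit d s S < BinCovering.opt d s) ∧
    -- the explicit family of instances
    (∀ ε : ℝ, 0 < ε → ε < 2 / 3 →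
      ∀ (d : Fin 4 → ℝ) (s : Fin 6 → ℝ),
        d = ![4, 3 - 2 * ε, 3 - 2 * ε, 3 - 2 * ε] →
        s = ![2 - ε, 2 - ε, 2 - ε, 1 - ε, 1 - ε, 1 - ε] →
        BinCovering.opt d s = 9 - 6 * ε ∧
        ∀ S, BinCovering.IsNFD d s S →
          BinCovering.profit d s S = 4 ∧
            9 / 4 - 2 * ε ≤ BinCovering.opt d s / BinCovering.profit d s S) := by
  refine ⟨fun m n d s hd hs => ⟨BinCovering.exists_isNFD d s,
    fun S h => ⟨h.isSolution, h.opt_le_profit hd hs⟩⟩, BinCovering.exists_program, ?_, ?_⟩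
  · intro ρ hρ
    -- the ratio of the instance for `ε` is `9 / 4 - 3 / 2 * ε`
    obtain ⟨ε, h0, h1, hε⟩ : ∃ ε : ℝ, 0 < ε ∧ ε < 2 / 3 ∧ ρ < 9 / 4 - 3 / 2 * ε :=
      ⟨min (1 / 3) ((9 / 4 - ρ) / 3), lt_min (by norm_num) (by linarith), by
        linarith [min_le_left (1 / 3) ((9 / 4 - ρ) / 3)], by
        linarith [min_le_right (1 / 3) ((9 / 4 - ρ) / 3)]⟩
    refine ⟨4, 6, BinCovering.tightDemand ε, BinCovering.tightSize ε,
      BinCovering.tightDemand_pos h1, BinCovering.tightSize_pos h1,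
      BinCovering.exists_isNFD _ _, fun S h => ?_⟩
    rw [h.profit_tight h0 h1, BinCovering.opt_tight h1]
    constructor <;> linarith
  · intro ε h0 h1 d s hd hs
    obtain rfl : d = BinCovering.tightDemand ε := hd
    obtain rfl : s = BinCovering.tightSize ε := hs
    refine ⟨BinCovering.opt_tight h1, fun S h => ?_⟩
    rw [h.profit_tight h0 h1, BinCovering.opt_tight h1]
    refine ⟨rfl, ?_⟩
    rw [le_div_iff₀ (by norm_num)]
    linarith
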